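/- Let $f\in\mathbb C\{X_1,X_2\}$ be an irreducible germ of holomorphic function at $0\in\mathbb C^2$ with multiplicity greater than $1$, defining the plane branch $\mathcal C=\{f=0\}$, and let $\varphi(T)=(\varphi_1(T),\varphi_2(T))\in\mathbb C\{T\}^2$ with $\varphi(0)=0$ be a primitive parametrization of $\mathcal C$: $f(\varphi(T))=0$, and $\varphi$ cannot be written as $\psi\circ\sigma$ with $\psi\in\mathbb C\{T\}^2$, $\sigma\in\mathbb C\{T\}$, $\sigma(0)=0$ and $\operatorname{ord}_T\sigma\neq 1$. Let $$\Gamma=\{\operatorname{ord}_T q(\varphi(T)) : q\in\mathbb C\{X_1,X_2\},\ q(\varphi(T))\neq 0\}$$ be the value semigroup of $\mathcal C$, and let $$\Lambda=\{\operatorname{ord}_T\big(A(\varphi)\varphi_1'+B(\varphi)\varphi_2'\big)+1 : A,B\in\mathbb C\{X_1,X_2\},\ A(\varphi)\varphi_1'+B(\varphi)\varphi_2'\neq 0\}$$ be the set of values of $1$-forms $A\,dX_1+B\,dX_2$ on $\mathcal C$. Put $\lambda_1=\min(\Lambda\setminus\Gamma)$, with $\lambda_1=\infty$ if $\Lambda\setminus\Gamma=\emptyset$,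 and $\mathcal G=\{l\in\mathbb N : l>\lambda_1,\ l\notin\Lambda\}$. Write $\Gamma=\langle v_0,\dots,v_g\rangle$ when $v_0<\dots<v_g$ and $\{v_0,\dots,v_g\}$ is the minimal set of generators of $\Gamma$. Then $\mathcal G=\emptyset$ if and only if one of the following holds: 1. $\Gamma=\langle v_0,v_1\rangle$ for some $v_0<v_1$, and $\lambda_1=\infty$; 2. $\Gamma=\langle v_0,v_1\rangle$ for some $v_0<v_1$, and $\lambda_1=(v_0-1)v_1-sv_0$ for some integer $s$ with $1\le s\le\left[\frac{v_1}{v_0}\right]+1$, where $[\,\cdot\,]$ denotes the integer part; 3. $\Gamma=\langle 4,6,v_2\rangle$ for some $v_2>6$. -/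

import Mathlib

open Filter Topology

/-- The ring `𝒪₂ = ℂ{X₁, X₂}` of germs at the origin of `ℂ²` of holomorphic functions. -/
def HolGerm : Subring (Germ (𝓝 (0 : ℂ × ℂ)) ℂ) where
  carrier := {g | ∃ F : ℂ × ℂ → ℂ, AnalyticAt ℂ F 0 ∧ (F : Germ (𝓝 (0 : ℂ × ℂ)) ℂ) = g}
  mul_mem' := by
    rintro _ _ ⟨F, hF, rfl⟩ ⟨H, hH, rfl⟩
    exact ⟨F * H, hF.mul hH, rfl⟩
  one_mem' := ⟨1, analyticAt_const, rfl⟩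
  add_mem' := by
    rintro _ _ ⟨F, hF, rfl⟩ ⟨H, hH, rfl⟩
    exact ⟨F + H, hF.add hH, rfl⟩
  zero_mem' := ⟨0, analyticAt_const, rfl⟩
  neg_mem' := by
    rintro _ ⟨F, hF, rfl⟩
    exact ⟨-F, hF.neg, rfl⟩

/-- The germ at the origin of a function holomorphic near the origin, as an element of `𝒪₂`. -/
noncomputable def HolGerm.of (F : ℂ × ℂ → ℂ) (hF : AnalyticAt ℂ F 0) : HolGerm :=
  ⟨(F : Germ (𝓝 (0 : ℂ × ℂ)) ℂ), F, hF, rfl⟩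

/-- `f` defines a (singular) plane branch: `f` is holomorphic near the origin, its germ is an
irreducible element of `𝒪₂`, and its multiplicity is greater than one, that is, its Taylor
expansion at the origin has neither a constant nor a linear term. -/
structure IsPlaneBranch (f : ℂ × ℂ → ℂ) : Prop where
  analyticAt : AnalyticAt ℂ f 0
  irreducible : Irreducible (HolGerm.of f analyticAt)
  map_zero : f 0 = 0
  fderiv_zero : fderiv ℂ f 0 = 0

/-- `φ` is a primitive parametrization of the branch `f = 0`: `φ` is holomorphic near `0`, maps `0`
to the origin, `f ∘ φ` vanishes identically near `0`, and `φ` is not a holomorphic function of a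
parameter `σ` of order greater than one. (If the first component of `φ` is `T ^ n`, with `n > 0`,
the last condition says that the exponents occurring in `φ` have greatest common divisor `1`.) -/
structure IsPrimitiveParametrization (f : ℂ × ℂ → ℂ) (φ : ℂ → ℂ × ℂ) : Prop where
  analyticAt : AnalyticAt ℂ φ 0
  map_zero : φ 0 = 0
  comp_eq_zero : ∀ᶠ t in 𝓝 (0 : ℂ), f (φ t) = 0
  primitive : ∀ (ψ : ℂ → ℂ × ℂ) (σ : ℂ → ℂ), AnalyticAt ℂ ψ 0 → AnalyticAt ℂ σ 0 → σ 0 = 0 →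
    (∀ᶠ t in 𝓝 (0 : ℂ), φ t = ψ (σ t)) → analyticOrderAt σ 0 = 1

/-- The value semigroup `Γ`: the set of the orders in `T` of the nonzero pullbacks `q (φ (T))`,
`q ∈ 𝒪₂`. (The order is `⊤` exactly when the pullback vanishes identically near `0`.) -/
def valueSemigroup (φ : ℂ → ℂ × ℂ) : Set ℕ :=
  {n | ∃ q : ℂ × ℂ → ℂ, AnalyticAt ℂ q 0 ∧ analyticOrderAt (fun t => q (φ t)) 0 = (n : ℕ∞)}

/-- The pullback `φ^*(A dx₁ + B dx₂) = A(φ) φ₁' + B(φ) φ₂'` of a `1`-form. -/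
noncomputable def pullbackForm (φ : ℂ → ℂ × ℂ) (A B : ℂ × ℂ → ℂ) (t : ℂ) : ℂ :=
  A (φ t) * deriv (fun u => (φ u).1) t + B (φ t) * deriv (fun u => (φ u).2) t

/-- The value set `Λ` of `1`-forms: the set of the values `ord_T (φ^* ω) + 1` over the holomorphic
`1`-forms `ω = A dx₁ + B dx₂` with `φ^* ω ≠ 0`. -/
def valueSetForms (φ : ℂ → ℂ × ℂ) : Set ℕ :=
  {n | ∃ A B : ℂ × ℂ → ℂ, AnalyticAt ℂ A 0 ∧ AnalyticAt ℂ B 0 ∧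
    analyticOrderAt (pullbackForm φ A B) 0 + 1 = (n : ℕ∞)}

/-- `λ₁ = min (Λ \ Γ)`, which is `∞` if `Λ \ Γ` is empty. -/
noncomputable def lambdaOne (φ : ℂ → ℂ × ℂ) : ℕ∞ :=
  ⨅ l ∈ valueSetForms φ \ valueSemigroup φ, (l : ℕ∞)

/-- `𝒢 = {l > λ₁ : l ∉ Λ}`. -/
def gapSet (φ : ℂ → ℂ × ℂ) : Set ℕ :=
  {l | lambdaOne φ < (l : ℕ∞) ∧ l ∉ valueSetForms φ}

/-- `V` is the minimal set of generators of the additive semigroup (with zero) `S`. -/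
def IsMinimalGeneratingSet (S V : Set ℕ) : Prop :=
  S = (AddSubmonoid.closure V : Set ℕ) ∧
    ∀ v ∈ V, v ∉ AddSubmonoid.closure (V \ {v})

/-!
The proof replaces germs by power series. For a parametrization `φ = (x, y)` the completed ring
`O = paramRing φ` consists of the `T`-adic limits of polynomials in `x` and `y`; since only finitely
many coefficients matter for an order, `Γ` is the set of orders of `O` (`valueSemigroup_eq`), and
`Λ` is the set of orders of the combinations `∑ a · D h` with `a, h ∈ O`, where `D = T d/dT`
(`valueSetForms_eq`). Irreducibility of `f` and `f'(0) = 0` enter only through the fact that `φ` is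
singular: a germ vanishing on a smooth curve is divisible by the equation of that curve
(`deriv_eq_zero_of_isPlaneBranch`). Primitivity enters only through `gcd Γ = 1`: after a change of
parameter `x = T ^ n`, the conjugates of `y` over `ℂ⟦T ^ n⟧` are distinct, and a Lagrange
interpolation sum shows that `O` contains all multiples of the different `∏ (y - y(z T))`
(`exists_consecutive_orders`).

Let `n < m` be the two smallest minimal generators of `Γ`, realized as the orders of coordinates
`x`, `y`, and let `η = m y dx - n x dy`. Modulo exact forms every form is a multiple of `η`
(`exists_exact_add_mul_eta`), and coordinate changes can be used to raise the value of `η` as long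
as it lies in `⟨n, m⟩` (`exists_raise_eta`). Once this is no longer possible, the value of `η` is
`λ₁`, and comparing `dh` with `p η` shows that an element `k` of `Λ` outside `Γ ∪ (λ₁ + Γ)` exceeds
some element of `Γ ∩ (λ₁ + Γ)` (`mem_orders_or_of_order_eta`). So there are gaps as soon as there
is an integer `k` slightly larger than `λ₁` that is neither in `Γ` nor in `λ₁ + Γ`.

If `n` and `m` are coprime, then `Γ = ⟨n, m⟩`, and writing `λ₁ = n m - a n - b m` such a `k` can be
given explicitly unless `b = 1` and `a ≤ [m / n] + 1`, in which case the gaps of `Γ` above `λ₁` lie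
in `λ₁ + ℕ n` (`BranchValues.exists_of_forall_mem`, `BranchValues.mem_of_exists`). If
`e = gcd n m > 1`, put `n = e n'` and `m = e m'`. The identity
`e (x df - m' f dx) = - y ^ (n' - 1) η` for `f = y ^ n' - x ^ m'` gives
`ord f = λ₁ + (n' - 1) m - n` (`order_approx_add`), and below `ord f` all elements of `Γ` are
multiples of `e`, by division with remainder by `f` (`mem_pairSemigroup_or`). Hence `λ₁ + 1` or
`λ₁ + 2` is a gap, except for `n = 4`, `m = 6`, where `Γ = ⟨4, 6, λ₁ + 2⟩` and nothing is missing
above `λ₁` (`BranchValues.eq_four_six_of_forall_mem`, `BranchValues.forall_mem_of_four_six`).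
-/

namespace PlaneCurve

open PowerSeries

/-! ### The Euler derivation and leading coefficients -/

/-- The Euler derivation `D = X · d/dX` of `ℂ⟦X⟧`. Working with `D` in place of `d/dX` shifts the
orders of pulled back forms by one, so that `D h` has the same order as `h` when `h(0) = 0`. -/
noncomputable def eulerD : Derivation ℂ (PowerSeries ℂ) (PowerSeries ℂ) :=
  (X : PowerSeries ℂ) • PowerSeries.derivative ℂ

lemma coeff_eulerD (h : PowerSeries ℂ) (k : ℕ) : coeff k (eulerD h) = k * coeff k h := by
  cases k with
  | zero => simp [eulerD]
  | succ k => simp [eulerD, coeff_succ_X_mul, coeff_derivative, mul_comm]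

lemma constantCoeff_eulerD (h : PowerSeries ℂ) : constantCoeff (eulerD h) = 0 := by
  simp [eulerD]

lemma X_pow_dvd_eulerD {h : PowerSeries ℂ} {N : ℕ} (hd : X ^ N ∣ h) : X ^ N ∣ eulerD h := by
  rw [X_pow_dvd_iff] at *
  intro k hk
  rw [coeff_eulerD, hd k hk, mul_zero]

lemma eulerD_X_pow (k : ℕ) : eulerD (X ^ k) = (k : PowerSeries ℂ) * X ^ k := by
  ext i
  rw [coeff_eulerD, ← map_natCast (C (R := ℂ)), coeff_C_mul, coeff_X_pow]
  split_ifs with h <;> simp [h]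

/-- `HasLead h k c` says that `h = c X^k + (higher order terms)`; the coefficient `c` is allowed to
vanish. -/
def HasLead (h : PowerSeries ℂ) (k : ℕ) (c : ℂ) : Prop :=
  ∃ u, h = X ^ k * u ∧ constantCoeff u = c

namespace HasLead

variable {h g : PowerSeries ℂ} {k l : ℕ} {c d : ℂ}

lemma mul (hh : HasLead h k c) (hg : HasLead g l d) : HasLead (h * g) (k + l) (c * d) := by
  obtain ⟨u, rfl, rfl⟩ := hh
  obtain ⟨v, rfl, rfl⟩ := hg
  exact ⟨u * v, by ring, by simp⟩

lemma const (c : ℂ) : HasLead (C c) 0 c := ⟨C c, by simp, by simp⟩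

lemma natCast (n : ℕ) : HasLead (n : PowerSeries ℂ) 0 n := ⟨n, by simp, by simp⟩

lemma pow (hh : HasLead h k c) (n : ℕ) : HasLead (h ^ n) (n * k) (c ^ n) := by
  obtain ⟨u, rfl, rfl⟩ := hh
  exact ⟨u ^ n, by ring, by simp⟩

lemma add (hh : HasLead h k c) (hg : HasLead g k d) : HasLead (h + g) k (c + d) := by
  obtain ⟨u, rfl, rfl⟩ := hh
  obtain ⟨v, rfl, rfl⟩ := hg
  exact ⟨u + v, by ring, by simp⟩

lemma sub (hh : HasLead h k c) (hg : HasLead g k d) : HasLead (h - g) k (c - d) := by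
  obtain ⟨u, rfl, rfl⟩ := hh
  obtain ⟨v, rfl, rfl⟩ := hg
  exact ⟨u - v, by ring, by simp⟩

lemma of_lt (hh : HasLead h k c) (hl : l < k) : HasLead h l 0 := by
  obtain ⟨u, rfl, rfl⟩ := hh
  obtain ⟨j, rfl⟩ := Nat.exists_eq_add_of_lt hl
  exact ⟨X ^ (j + 1) * u, by ring, by simp⟩

lemma succ (hh : HasLead h k 0) : ∃ c, HasLead h (k + 1) c := by
  obtain ⟨u, rfl, hu⟩ := hh
  obtain ⟨v, rfl⟩ := X_dvd_iff.2 hu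
  exact ⟨_, v, by ring, rfl⟩

lemma eulerD (hh : HasLead h k c) : HasLead (eulerD h) k (k * c) := by
  obtain ⟨u, rfl, rfl⟩ := hh
  refine ⟨k * u + PlaneCurve.eulerD u, ?_, ?_⟩
  · rw [Derivation.leibniz, eulerD_X_pow]
    simp only [smul_eq_mul]
    ring
  · simp [constantCoeff_eulerD]

lemma order_eq (hh : HasLead h k c) (hc : c ≠ 0) : h.order = k := by
  obtain ⟨u, rfl, rfl⟩ := hh
  rw [order_mul, order_X_pow, order_zero_of_unit, add_zero]
  rwa [isUnit_iff_constantCoeff, isUnit_iff_ne_zero]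

lemma X_pow_dvd (hh : HasLead h k c) : X ^ k ∣ h := by
  obtain ⟨u, rfl, rfl⟩ := hh
  exact dvd_mul_right _ _

lemma le_order (hh : HasLead h k c) : (k : ℕ∞) ≤ h.order := by
  obtain ⟨u, rfl, rfl⟩ := hh
  rw [order_mul, order_X_pow]
  exact le_self_add

end HasLead

lemma X_pow_dvd_iff_le_order {h : PowerSeries ℂ} {k : ℕ} : X ^ k ∣ h ↔ (k : ℕ∞) ≤ h.order := by
  constructor
  · rintro ⟨u, rfl⟩
    rw [order_mul, order_X_pow]
    exact le_self_add
  · intro hk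
    rw [X_pow_dvd_iff]
    intro m hm
    exact coeff_of_lt_order m (lt_of_lt_of_le (by exact_mod_cast hm) hk)

lemma hasLead_of_X_pow_dvd {h : PowerSeries ℂ} {k : ℕ} (hk : X ^ k ∣ h) :
    ∃ c, HasLead h k c := by
  obtain ⟨u, rfl⟩ := hk
  exact ⟨_, u, rfl, rfl⟩

lemma exists_hasLead_of_order_eq {h : PowerSeries ℂ} {k : ℕ} (hk : h.order = k) :
    ∃ c, c ≠ 0 ∧ HasLead h k c := by
  obtain ⟨c, hc⟩ := hasLead_of_X_pow_dvd (X_pow_dvd_iff_le_order.2 hk.ge)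
  refine ⟨c, ?_, hc⟩
  rintro rfl
  obtain ⟨c, hc⟩ := hc.succ
  have := hc.le_order
  rw [hk] at this
  norm_cast at this
  omega

lemma order_eulerD {h : PowerSeries ℂ} (h0 : constantCoeff h = 0) :
    (eulerD h).order = h.order := by
  by_cases hh : h = 0
  · simp [hh]
  obtain ⟨k, hk⟩ := ENat.ne_top_iff_exists.1 (order_finite_iff_ne_zero.2 hh).ne
  obtain ⟨c, hc, hl⟩ := exists_hasLead_of_order_eq hk.symm
  have hk0 : k ≠ 0 := by
    rintro rfl
    obtain ⟨u, rfl, rfl⟩ := hl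
    simp at h0
    exact hc h0
  rw [← hk, hl.eulerD.order_eq (mul_ne_zero (by exact_mod_cast hk0) hc)]

lemma order_eq_of_X_pow_dvd_sub {h g : PowerSeries ℂ} {k N : ℕ} (hk : h.order = k) (hN : k < N)
    (hd : X ^ N ∣ h - g) : g.order = k := by
  obtain ⟨c, hc, hl⟩ := exists_hasLead_of_order_eq hk
  obtain ⟨d, hd'⟩ := hasLead_of_X_pow_dvd hd
  have := hl.sub (hd'.of_lt hN)
  rw [sub_sub_cancel, sub_zero] at this
  exact this.order_eq hc

/-! ### The completed ring of a parametrization -/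

/-- The `X`-adic closure of a subalgebra of `ℂ⟦X⟧`. -/
noncomputable def adicClosure (A : Subalgebra ℂ (PowerSeries ℂ)) :
    Subalgebra ℂ (PowerSeries ℂ) where
  carrier := {h | ∀ N : ℕ, ∃ a ∈ A, X ^ N ∣ h - a}
  mul_mem' := by
    intro h g hh hg N
    obtain ⟨a, ha, hda⟩ := hh N
    obtain ⟨b, hb, hdb⟩ := hg N
    refine ⟨a * b, mul_mem ha hb, ?_⟩
    have : h * g - a * b = (h - a) * g + a * (g - b) := by ring
    rw [this]
    exact dvd_add (hda.mul_right _) (hdb.mul_left _)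
  add_mem' := by
    intro h g hh hg N
    obtain ⟨a, ha, hda⟩ := hh N
    obtain ⟨b, hb, hdb⟩ := hg N
    refine ⟨a + b, add_mem ha hb, ?_⟩
    rw [add_sub_add_comm]
    exact dvd_add hda hdb
  algebraMap_mem' := fun r N => ⟨_, A.algebraMap_mem r, by simp⟩

lemma le_adicClosure (A : Subalgebra ℂ (PowerSeries ℂ)) : A ≤ adicClosure A :=
  fun a ha _ => ⟨a, ha, by simp⟩

lemma adicClosure_le {A B : Subalgebra ℂ (PowerSeries ℂ)} (h : A ≤ adicClosure B) :
    adicClosure A ≤ adicClosure B := by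
  intro a ha N
  obtain ⟨b, hb, hdb⟩ := ha N
  obtain ⟨c, hc, hdc⟩ := h hb N
  exact ⟨c, hc, by simpa using dvd_add hdb hdc⟩

/-- The completed local ring of the curve parametrized by `(x, y)`: all power series that are
`X`-adic limits of polynomials in `x` and `y`. -/
noncomputable def curveRing (x y : PowerSeries ℂ) : Subalgebra ℂ (PowerSeries ℂ) :=
  adicClosure (Algebra.adjoin ℂ {x, y})

lemma curveRing_comm (x y : PowerSeries ℂ) : curveRing x y = curveRing y x := by
  rw [curveRing, Set.pair_comm, curveRing]

lemma adjoin_le_curveRing (x y : PowerSeries ℂ) : Algebra.adjoin ℂ {x, y} ≤ curveRing x y :=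
  le_adicClosure _

lemma left_mem_adjoin (x y : PowerSeries ℂ) : x ∈ Algebra.adjoin ℂ {x, y} :=
  Algebra.subset_adjoin (by simp)

lemma right_mem_adjoin (x y : PowerSeries ℂ) : y ∈ Algebra.adjoin ℂ {x, y} :=
  Algebra.subset_adjoin (by simp)

lemma left_mem_curveRing (x y : PowerSeries ℂ) : x ∈ curveRing x y :=
  adjoin_le_curveRing _ _ (left_mem_adjoin x y)

lemma right_mem_curveRing (x y : PowerSeries ℂ) : y ∈ curveRing x y :=
  adjoin_le_curveRing _ _ (right_mem_adjoin x y)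

lemma C_mem (A : Subalgebra ℂ (PowerSeries ℂ)) (c : ℂ) : C c ∈ A := A.algebraMap_mem c

lemma curveRing_le {x y u v : PowerSeries ℂ} (hx : x ∈ curveRing u v) (hy : y ∈ curveRing u v) :
    curveRing x y ≤ curveRing u v := by
  apply adicClosure_le
  apply Algebra.adjoin_le
  rintro z (rfl | rfl)
  exacts [hx, hy]

/-- A polynomial coordinate change `x ↦ x + a y ^ j x ^ i` with `j ≥ 1`, other than a rescaling of
`x`, does not change the completed ring. -/
lemma curveRing_change {x y : PowerSeries ℂ} (hy : constantCoeff y = 0) (a : ℂ) {i j : ℕ}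
    (hj : 1 ≤ j) : curveRing (x + C a * (y ^ j * x ^ i)) y = curveRing x y := by
  set z := x + C a * (y ^ j * x ^ i) with hz
  have hyz : y ∈ Algebra.adjoin ℂ {z, y} := right_mem_adjoin z y
  have hzz : z ∈ Algebra.adjoin ℂ {z, y} := left_mem_adjoin z y
  apply le_antisymm
  · refine curveRing_le ?_ (right_mem_curveRing _ _)
    exact add_mem (left_mem_curveRing _ _) (mul_mem (C_mem _ _)
      (mul_mem (pow_mem (right_mem_curveRing _ _) _) (pow_mem (left_mem_curveRing _ _) _)))
  · refine curveRing_le ?_ (right_mem_curveRing _ _)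
    -- Solve `x = z - a y ^ j x ^ i` for `x` by iteration: each step gains a factor of `y`.
    intro N
    induction N with
    | zero => exact ⟨0, zero_mem _, by simp⟩
    | succ N ih =>
      obtain ⟨b, hb, hd⟩ := ih
      refine ⟨z - C a * (y ^ j * b ^ i), sub_mem hzz (mul_mem (C_mem _ _)
        (mul_mem (pow_mem hyz _) (pow_mem hb _))), ?_⟩
      have : x - (z - C a * (y ^ j * b ^ i)) = y ^ j * (b ^ i - x ^ i) * C a := by
        rw [hz]; ring
      rw [this, pow_succ']
      refine Dvd.dvd.mul_right (mul_dvd_mul ?_ ?_) _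
      · exact (X_dvd_iff.2 hy).trans (dvd_pow_self y (by omega))
      · exact (by simpa using hd.neg_right : X ^ N ∣ b - x).trans (sub_dvd_pow_sub_pow _ _ _)

/-! ### Values of functions and of forms -/

/-- The set of the (finite) orders of the elements of a ring of power series. -/
def orders (O : Subalgebra ℂ (PowerSeries ℂ)) : Set ℕ := {k | ∃ h ∈ O, h.order = k}

/-- The differential forms on the curve with ring `O`, multiplied by `X`: the span of the
products `a · D h` with `a, h ∈ O`. -/
noncomputable def forms (O : Subalgebra ℂ (PowerSeries ℂ)) : Submodule ℂ (PowerSeries ℂ) :=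
  Submodule.span ℂ {w | ∃ a ∈ O, ∃ h ∈ O, w = a * eulerD h}

/-- The set of the values of the differential forms on the curve with ring `O`. -/
def formOrders (O : Subalgebra ℂ (PowerSeries ℂ)) : Set ℕ := {k | ∃ w ∈ forms O, w.order = k}

section values

variable {O : Subalgebra ℂ (PowerSeries ℂ)} {k l : ℕ}

lemma zero_mem_orders : 0 ∈ orders O := ⟨1, one_mem _, by simp⟩

lemma add_mem_orders (hk : k ∈ orders O) (hl : l ∈ orders O) : k + l ∈ orders O := by
  obtain ⟨h, hh, hk⟩ := hk
  obtain ⟨g, hg, hl⟩ := hl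
  exact ⟨h * g, mul_mem hh hg, by rw [order_mul, hk, hl]; simp⟩

lemma eulerD_mem_forms {h : PowerSeries ℂ} (hh : h ∈ O) : eulerD h ∈ forms O :=
  Submodule.subset_span ⟨1, one_mem _, h, hh, by simp⟩

lemma mul_mem_forms {a w : PowerSeries ℂ} (ha : a ∈ O) (hw : w ∈ forms O) : a * w ∈ forms O := by
  induction hw using Submodule.span_induction with
  | mem w hw =>
    obtain ⟨b, hb, h, hh, rfl⟩ := hw
    exact Submodule.subset_span ⟨a * b, mul_mem ha hb, h, hh, by ring⟩
  | zero => simp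
  | add u v _ _ hu hv => rw [mul_add]; exact add_mem hu hv
  | smul c u _ hu => rw [mul_smul_comm]; exact Submodule.smul_mem _ _ hu

lemma mem_formOrders_of_mem_orders (hk : k ∈ orders O) (h0 : k ≠ 0) : k ∈ formOrders O := by
  obtain ⟨h, hh, hk⟩ := hk
  refine ⟨eulerD h, eulerD_mem_forms hh, ?_⟩
  rw [order_eulerD, hk]
  rw [← order_ne_zero_iff_constCoeff_eq_zero, hk]
  exact_mod_cast h0

lemma add_mem_formOrders (hk : k ∈ orders O) (hl : l ∈ formOrders O) : k + l ∈ formOrders O := by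
  obtain ⟨h, hh, hk⟩ := hk
  obtain ⟨w, hw, hl⟩ := hl
  exact ⟨h * w, mul_mem_forms hh hw, by rw [order_mul, hk, hl]; simp⟩

lemma mem_orders_of_order_eulerD {h : PowerSeries ℂ} (hh : h ∈ O) (hk : (eulerD h).order = k) :
    k ∈ orders O := by
  refine ⟨h - C (constantCoeff h), sub_mem hh (C_mem _ _), ?_⟩
  rw [← order_eulerD (by simp), map_sub, show eulerD (C (constantCoeff h)) = 0 from
    eulerD.map_algebraMap _, sub_zero, hk]

end values

lemma eulerD_C (c : ℂ) : eulerD (C c) = 0 := eulerD.map_algebraMap c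

lemma eulerD_natCast (c : ℕ) : eulerD (c : PowerSeries ℂ) = 0 := eulerD.map_natCast c

lemma exists_eulerD_eq_of_mem_adjoin {x y h : PowerSeries ℂ}
    (hh : h ∈ Algebra.adjoin ℂ {x, y}) : ∃ a ∈ Algebra.adjoin ℂ {x, y},
      ∃ b ∈ Algebra.adjoin ℂ {x, y}, eulerD h = a * eulerD x + b * eulerD y := by
  induction hh using Algebra.adjoin_induction with
  | mem z hz =>
    rcases hz with rfl | rfl
    · exact ⟨1, one_mem _, 0, zero_mem _, by simp⟩
    · exact ⟨0, zero_mem _, 1, one_mem _, by simp⟩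
  | algebraMap r => exact ⟨0, zero_mem _, 0, zero_mem _, by simp [eulerD_C]⟩
  | add u v _ _ hu hv =>
    obtain ⟨a, ha, b, hb, hu⟩ := hu
    obtain ⟨c, hc, d, hd, hv⟩ := hv
    exact ⟨a + c, add_mem ha hc, b + d, add_mem hb hd, by rw [map_add, hu, hv]; ring⟩
  | mul u v hu' hv' hu hv =>
    obtain ⟨a, ha, b, hb, hu⟩ := hu
    obtain ⟨c, hc, d, hd, hv⟩ := hv
    refine ⟨u * c + v * a, add_mem (mul_mem hu' hc) (mul_mem hv' ha), u * d + v * b,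
      add_mem (mul_mem hu' hd) (mul_mem hv' hb), ?_⟩
    rw [Derivation.leibniz, hu, hv]
    simp only [smul_eq_mul]
    ring

lemma exists_adjoin_of_mem_forms {x y w : PowerSeries ℂ} (hw : w ∈ forms (curveRing x y))
    (N : ℕ) : ∃ a ∈ Algebra.adjoin ℂ {x, y}, ∃ b ∈ Algebra.adjoin ℂ {x, y},
      X ^ N ∣ w - (a * eulerD x + b * eulerD y) := by
  induction hw using Submodule.span_induction with
  | mem w hw =>
    obtain ⟨f, hf, h, hh, rfl⟩ := hw
    obtain ⟨p, hp, hdp⟩ := hf N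
    obtain ⟨q, hq, hdq⟩ := hh N
    obtain ⟨a, ha, b, hb, hab⟩ := exists_eulerD_eq_of_mem_adjoin hq
    refine ⟨p * a, mul_mem hp ha, p * b, mul_mem hp hb, ?_⟩
    have : f * eulerD h - (p * a * eulerD x + p * b * eulerD y) =
        (f - p) * eulerD h + p * eulerD (h - q) := by
      rw [map_sub, hab]; ring
    rw [this]
    exact dvd_add (hdp.mul_right _) ((X_pow_dvd_eulerD hdq).mul_left _)
  | zero => exact ⟨0, zero_mem _, 0, zero_mem _, by simp⟩
  | add u v _ _ hu hv =>
    obtain ⟨a, ha, b, hb, hu⟩ := hu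
    obtain ⟨c, hc, d, hd, hv⟩ := hv
    refine ⟨a + c, add_mem ha hc, b + d, add_mem hb hd, ?_⟩
    convert dvd_add hu hv using 1
    ring
  | smul r u _ hu =>
    obtain ⟨a, ha, b, hb, hu⟩ := hu
    refine ⟨C r * a, mul_mem (C_mem _ _) ha, C r * b, mul_mem (C_mem _ _) hb, ?_⟩
    convert hu.mul_left (C r) using 1
    rw [smul_eq_C_mul]
    ring

/-! ### The form `η = m y dx - n x dy` -/

/-- The form `m y dx - n x dy` (multiplied by `X`), for `n` and `m` the orders of `x` and `y`. -/
noncomputable def eta (n m : ℕ) (x y : PowerSeries ℂ) : PowerSeries ℂ :=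
  m * y * eulerD x - n * x * eulerD y

lemma eta_mem_forms (n m : ℕ) (x y : PowerSeries ℂ) : eta n m x y ∈ forms (curveRing x y) := by
  refine sub_mem (mul_mem_forms (mul_mem ?_ (right_mem_curveRing x y))
    (eulerD_mem_forms (left_mem_curveRing x y))) (mul_mem_forms
    (mul_mem ?_ (left_mem_curveRing x y)) (eulerD_mem_forms (right_mem_curveRing x y)))
  exacts [natCast_mem _ _, natCast_mem _ _]

lemma eta_swap (n m : ℕ) (x y : PowerSeries ℂ) : eta m n y x = - eta n m x y := by
  rw [eta, eta]; ring

/-- The subspace of the elements `dh + p η`, where `h` and `p` are polynomials in `x` and `y`. -/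
noncomputable def exactAddEta (n m : ℕ) (x y : PowerSeries ℂ) :
    Submodule ℂ (PowerSeries ℂ) where
  carrier := {w | ∃ h ∈ Algebra.adjoin ℂ {x, y}, ∃ p ∈ Algebra.adjoin ℂ {x, y},
    w = eulerD h + p * eta n m x y}
  add_mem' := by
    rintro _ _ ⟨h, hh, p, hp, rfl⟩ ⟨k, hk, q, hq, rfl⟩
    exact ⟨h + k, add_mem hh hk, p + q, add_mem hp hq, by rw [map_add]; ring⟩
  zero_mem' := ⟨0, zero_mem _, 0, zero_mem _, by simp⟩
  smul_mem' := by
    rintro c _ ⟨h, hh, p, hp, rfl⟩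
    exact ⟨c • h, Subalgebra.smul_mem _ hh _, c • p, Subalgebra.smul_mem _ hp _, by
      rw [Derivation.map_smul, smul_add, smul_mul_assoc]⟩

lemma exactAddEta_swap (n m : ℕ) (x y : PowerSeries ℂ) :
    exactAddEta m n y x = exactAddEta n m x y := by
  ext w
  constructor <;> rintro ⟨h, hh, p, hp, rfl⟩
  · rw [Set.pair_comm] at hh hp
    exact ⟨h, hh, -p, neg_mem hp, by rw [eta_swap]; ring⟩
  · rw [Set.pair_comm] at hh hp
    exact ⟨h, hh, -p, neg_mem hp, by rw [eta_swap]; ring⟩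

lemma mem_of_natCast_mul_mem {M : Submodule ℂ (PowerSeries ℂ)} {k : ℕ} (hk : k ≠ 0)
    {w : PowerSeries ℂ} (hw : (k : PowerSeries ℂ) * w ∈ M) : w ∈ M := by
  have := M.smul_mem (k : ℂ)⁻¹ hw
  rwa [← map_natCast (C (R := ℂ)), ← smul_eq_C_mul, smul_smul, inv_mul_cancel₀, one_smul] at this
  exact_mod_cast hk

lemma monomial_mul_eulerD_mem {n : ℕ} (hn : n ≠ 0) (m : ℕ) (x y : PowerSeries ℂ) (i j : ℕ) :
    x ^ i * y ^ j * eulerD x ∈ exactAddEta n m x y := by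
  have hx := left_mem_adjoin x y
  have hy := right_mem_adjoin x y
  cases j with
  | zero =>
    apply mem_of_natCast_mul_mem (Nat.succ_ne_zero i)
    refine ⟨x ^ (i + 1), pow_mem hx _, 0, zero_mem _, ?_⟩
    simp
  | succ j =>
    apply mem_of_natCast_mul_mem (k := n * (i + 1) + m * (j + 1)) (by positivity)
    refine ⟨n * (x ^ (i + 1) * y ^ (j + 1)), mul_mem (natCast_mem _ _)
      (mul_mem (pow_mem hx _) (pow_mem hy _)), (j + 1 : ℕ) * (x ^ i * y ^ j),
      mul_mem (natCast_mem _ _) (mul_mem (pow_mem hx _) (pow_mem hy _)), ?_⟩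
    rw [eta, Derivation.leibniz, Derivation.leibniz, eulerD_natCast, Derivation.leibniz_pow,
      Derivation.leibniz_pow]
    simp only [smul_eq_mul, nsmul_eq_mul, add_tsub_cancel_right]
    push_cast
    ring

lemma mul_eulerD_left_mem {n : ℕ} (hn : n ≠ 0) (m : ℕ) {x y a : PowerSeries ℂ}
    (ha : a ∈ Algebra.adjoin ℂ {x, y}) : a * eulerD x ∈ exactAddEta n m x y := by
  rw [← Subalgebra.mem_toSubmodule, Algebra.adjoin_eq_span] at ha
  induction ha using Submodule.span_induction with
  | mem a ha =>
    obtain ⟨i, j, rfl⟩ := (Submonoid.mem_closure_pair _ _ _).1 ha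
    exact monomial_mul_eulerD_mem hn m x y i j
  | zero => simp
  | add u v _ _ hu hv => rw [add_mul]; exact add_mem hu hv
  | smul c u _ hu => rw [smul_mul_assoc]; exact Submodule.smul_mem _ _ hu

/-- Every form is of the shape `dh + p η`, to any finite precision: modulo exact forms, the
monomial forms are multiples of `η`. -/
lemma exists_exact_add_mul_eta {n m : ℕ} (hn : n ≠ 0) (hm : m ≠ 0) {x y w : PowerSeries ℂ}
    (hw : w ∈ forms (curveRing x y)) (N : ℕ) : ∃ h ∈ curveRing x y, ∃ p ∈ curveRing x y,
      X ^ N ∣ w - (eulerD h + p * eta n m x y) := by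
  obtain ⟨a, ha, b, hb, hd⟩ := exists_adjoin_of_mem_forms hw N
  have hbm := mul_eulerD_left_mem hm n (y := x) (by rwa [Set.pair_comm])
  rw [exactAddEta_swap] at hbm
  obtain ⟨h, hh, p, hp, he⟩ := add_mem (mul_eulerD_left_mem hn m ha) hbm
  rw [he] at hd
  exact ⟨h, adjoin_le_curveRing _ _ hh, p, adjoin_le_curveRing _ _ hp, hd⟩

/-- A value of a form that is smaller than the value of `η` is the value of a function. -/
lemma mem_orders_of_lt_order_eta {n m : ℕ} (hn : n ≠ 0) (hm : m ≠ 0) {x y : PowerSeries ℂ}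
    {k : ℕ} (hk : k ∈ formOrders (curveRing x y)) (hlt : (k : ℕ∞) < (eta n m x y).order) :
    k ∈ orders (curveRing x y) := by
  obtain ⟨w, hw, hk⟩ := hk
  obtain ⟨h, hh, p, hp, hd⟩ := exists_exact_add_mul_eta hn hm hw (k + 1)
  have h1 := order_eq_of_X_pow_dvd_sub hk (Nat.lt_succ_self k) hd
  refine mem_orders_of_order_eulerD hh
    (order_eq_of_X_pow_dvd_sub (N := k + 1) h1 (Nat.lt_succ_self k) ?_)
  rw [add_sub_cancel_left, X_pow_dvd_iff_le_order, order_mul]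
  push_cast
  exact (Order.add_one_le_of_lt hlt).trans le_add_self

/-- If `η` has the value `l`, then the value `k` of a form is the value of a function, or of a
multiple of `η`, or it is larger than some value common to functions and multiples of `η`. -/
lemma mem_orders_or_of_order_eta {n m : ℕ} (hn : n ≠ 0) (hm : m ≠ 0) {x y : PowerSeries ℂ}
    {k l : ℕ} (hk : k ∈ formOrders (curveRing x y)) (hl : (eta n m x y).order = l) :
    k ∈ orders (curveRing x y) ∨ (∃ g ∈ orders (curveRing x y), k = l + g) ∨
      ∃ g ∈ orders (curveRing x y), l + g ∈ orders (curveRing x y) ∧ l + g < k := by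
  obtain ⟨w, hw, hk⟩ := hk
  obtain ⟨h, hh, p, hp, hd⟩ := exists_exact_add_mul_eta hn hm hw (k + 1)
  have h1 := order_eq_of_X_pow_dvd_sub hk (Nat.lt_succ_self k) hd
  have hpe : (p * eta n m x y).order = p.order + l := by rw [order_mul, hl]
  by_cases he : (eulerD h).order = (p * eta n m x y).order
  · have hle := min_order_le_order_add (eulerD h) (p * eta n m x y)
    rw [h1, he, min_self, hpe] at hle
    have htop : p.order ≠ ⊤ := by
      rintro ht
      rw [ht] at hle
      simp at hle
    obtain ⟨g, hg⟩ := ENat.ne_top_iff_exists.1 htop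
    rw [hpe, ← hg] at he
    rw [← hg] at hle
    have hmem : l + g ∈ orders (curveRing x y) :=
      mem_orders_of_order_eulerD hh (by rw [he]; push_cast; ring)
    norm_cast at hle
    rcases eq_or_lt_of_le hle with h2 | h2
    · left; rwa [← h2, add_comm]
    · exact Or.inr (Or.inr ⟨g, ⟨p, hp, hg.symm⟩, hmem, by omega⟩)
  · rw [order_add_of_order_ne _ _ he] at h1
    rcases min_choice (eulerD h).order (p * eta n m x y).order with h2 | h2
    · exact Or.inl (mem_orders_of_order_eulerD hh (h2 ▸ h1))
    · rw [h2, hpe] at h1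
      have htop : p.order ≠ ⊤ := by
        rintro ht
        rw [ht] at h1
        simp at h1
      obtain ⟨g, hg⟩ := ENat.ne_top_iff_exists.1 htop
      rw [← hg] at h1
      norm_cast at h1
      exact Or.inr (Or.inl ⟨g, ⟨p, hp, hg.symm⟩, by omega⟩)

/-! ### Division by the approximate equation `y ^ n' = x ^ m'` -/

/-- The additive semigroup generated by `n` and `m`. -/
def pairSemigroup (n m : ℕ) : Set ℕ := {k | ∃ i j : ℕ, k = i * n + j * m}

lemma order_sum_of_injOn {ι : Type*} (s : Finset ι) (f : ι → PowerSeries ℂ)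
    (hf : ∀ i ∈ s, ∀ j ∈ s, f i ≠ 0 → (f i).order = (f j).order → i = j) :
    ∑ i ∈ s, f i = 0 ∨ ∃ i ∈ s, f i ≠ 0 ∧ (∑ i ∈ s, f i).order = (f i).order := by
  classical
  induction s using Finset.induction_on with
  | empty => simp
  | insert a s ha ih =>
    rw [Finset.sum_insert ha]
    have ih := ih fun i hi j hj => hf i (by simp [hi]) j (by simp [hj])
    by_cases hfa : f a = 0
    · rw [hfa, zero_add]
      exact ih.imp_right fun ⟨i, hi, h⟩ => ⟨i, by simp [hi], h⟩
    right
    rcases ih with ih | ⟨i, hi, hi0, ih⟩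
    · exact ⟨a, by simp, hfa, by rw [ih, add_zero]⟩
    · have hne : (f a).order ≠ (∑ i ∈ s, f i).order := by
        rw [ih]
        intro he
        exact ha (hf a (by simp) i (by simp [hi]) hfa he ▸ hi)
      rw [order_add_of_order_ne _ _ hne]
      rcases min_choice (f a).order (∑ i ∈ s, f i).order with h2 | h2
      · exact ⟨a, by simp, hfa, h2⟩
      · exact ⟨i, by simp [hi], hi0, by rw [h2, ih]⟩

lemma order_aeval {x : PowerSeries ℂ} {n : ℕ} (hn : n ≠ 0) (hx : x.order = n)
    {p : Polynomial ℂ} (hp : p ≠ 0) : ∃ k : ℕ, (Polynomial.aeval x p).order = (k * n : ℕ) := by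
  obtain ⟨q, hq, hdvd⟩ := Polynomial.exists_eq_pow_rootMultiplicity_mul_and_not_dvd p hp 0
  have hx0 : constantCoeff x = 0 := by
    rw [← order_ne_zero_iff_constCoeff_eq_zero, hx]
    exact_mod_cast hn
  rw [map_zero, sub_zero] at hq hdvd
  refine ⟨p.rootMultiplicity 0, ?_⟩
  rw [hq, map_mul, map_pow, Polynomial.aeval_X, order_mul, order_pow, hx, order_zero_of_unit]
  · simp [nsmul_eq_mul, ← hq]
  · rw [isUnit_iff_constantCoeff, isUnit_iff_ne_zero, Polynomial.aeval_def,
      Polynomial.hom_eval₂, hx0]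
    rw [Polynomial.X_dvd_iff, Polynomial.coeff_zero_eq_eval_zero] at hdvd
    convert hdvd using 1
    rw [Polynomial.eval, show (constantCoeff (R := ℂ)).comp (algebraMap ℂ _) = RingHom.id ℂ from ?_]
    ext z
    simp

/-- The orders of the nonzero polynomials in `x`, `y` of degree less than `n / gcd n m` in `y` are
combinations of `n` and `m`: the monomials `x ^ i y ^ j` have distinct orders. -/
lemma order_aevalAeval_mem {x y : PowerSeries ℂ} {e n m : ℕ} (he : e ≠ 0) (hn : n ≠ 0)
    (hco : n.Coprime m) (hx : x.order = (e * n : ℕ)) (hy : y.order = (e * m : ℕ))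
    {r : Polynomial (Polynomial ℂ)} (hr : r.natDegree < n) :
    r.aevalAeval x y = 0 ∨
      ∃ k ∈ pairSemigroup (e * n) (e * m), (r.aevalAeval x y).order = k := by
  have hen : e * n ≠ 0 := mul_ne_zero he hn
  have hsum : r.aevalAeval x y =
      ∑ j ∈ Finset.range n, Polynomial.aeval x (r.coeff j) * y ^ j := by
    conv_lhs => rw [Polynomial.as_sum_range' r n hr]
    simp only [map_sum, ← Polynomial.C_mul_X_pow_eq_monomial, map_mul, map_pow,
      Polynomial.aevalAeval_C, Polynomial.aevalAeval_Y]
  have hterm : ∀ j, r.coeff j ≠ 0 → ∃ k : ℕ,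
      (Polynomial.aeval x (r.coeff j) * y ^ j).order = (k * (e * n) + j * (e * m) : ℕ) := by
    intro j hj
    obtain ⟨k, hk⟩ := order_aeval hen hx hj
    refine ⟨k, ?_⟩
    rw [order_mul, hk, order_pow, hy]
    simp [nsmul_eq_mul]
  rw [hsum]
  refine (order_sum_of_injOn _ _ ?_).imp_right ?_
  · intro i hi j hj hi0 hij
    have hci : r.coeff i ≠ 0 := by rintro h; simp [h] at hi0
    have hcj : r.coeff j ≠ 0 := by
      intro h
      rw [h] at hij
      simp only [map_zero, zero_mul, order_zero, order_eq_top] at hij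
      exact hi0 hij
    obtain ⟨a, ha⟩ := hterm i hci
    obtain ⟨b, hb⟩ := hterm j hcj
    rw [ha, hb] at hij
    norm_cast at hij
    have h1 : a * n + i * m = b * n + j * m := by
      apply Nat.eq_of_mul_eq_mul_left (Nat.pos_of_ne_zero he)
      linarith
    have h2 : i * m ≡ j * m [MOD n] := by
      have : a * n + i * m ≡ b * n + j * m [MOD n] := by rw [h1]
      simpa [Nat.ModEq, Nat.add_mod] using this
    have h3 : i ≡ j [MOD n] := Nat.ModEq.cancel_right_of_coprime (by simpa using hco) h2
    exact Nat.ModEq.eq_of_lt_of_lt h3 (Finset.mem_range.1 hi) (Finset.mem_range.1 hj)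
  · rintro ⟨j, hj, hj0, h⟩
    obtain ⟨k, hk⟩ := hterm j (by rintro h; simp [h] at hj0)
    exact ⟨_, ⟨k, j, rfl⟩, by rw [h, hk]⟩

/-- Division with remainder by `y ^ n - x ^ m`. -/
lemma exists_remainder {x y : PowerSeries ℂ} {e n m : ℕ} (he : e ≠ 0) (hn : n ≠ 0)
    (hco : n.Coprime m) (hx : x.order = (e * n : ℕ)) (hy : y.order = (e * m : ℕ))
    {h : PowerSeries ℂ} (hh : h ∈ curveRing x y) (N : ℕ) :
    ∃ r : PowerSeries ℂ, (r = 0 ∨ ∃ k ∈ pairSemigroup (e * n) (e * m), r.order = k) ∧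
      ∃ q ∈ curveRing x y, X ^ N ∣ h - (r + (y ^ n - x ^ m) * q) := by
  have hrange : (Polynomial.aevalAeval (R := ℂ) x y).range ≤ curveRing x y := by
    rintro _ ⟨P, rfl⟩
    induction P using Polynomial.induction_on' with
    | add p q hp hq => rw [map_add]; exact add_mem hp hq
    | monomial i a =>
      rw [← Polynomial.C_mul_X_pow_eq_monomial, map_mul, map_pow]
      refine mul_mem ?_ (pow_mem ?_ _)
      · simp only [AlgHom.toRingHom_eq_coe, RingHom.coe_coe, Polynomial.aevalAeval_C]
        exact Algebra.adjoin_le (by simpa using left_mem_curveRing x y)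
          (Polynomial.aeval_mem_adjoin_singleton ℂ x)
      · simpa using right_mem_curveRing x y
  obtain ⟨a, ha, hd⟩ := hh N
  have ha' : a ∈ (Polynomial.aevalAeval (R := ℂ) x y).range := by
    refine Algebra.adjoin_le ?_ ha
    rintro z (rfl | rfl)
    exacts [⟨Polynomial.C Polynomial.X, Polynomial.aevalAeval_X _ _⟩,
      ⟨Polynomial.X, Polynomial.aevalAeval_Y _ _⟩]
  obtain ⟨P, rfl⟩ := ha'
  set F : Polynomial (Polynomial ℂ) :=
    Polynomial.X ^ n - Polynomial.C (Polynomial.X ^ m) with hF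
  have hmonic : F.Monic := Polynomial.monic_X_pow_sub_C _ hn
  have hdeg : (P.modByMonic F).natDegree < n := by
    have hFd : F.natDegree = n := Polynomial.natDegree_X_pow_sub_C
    rw [← hFd]
    exact Polynomial.natDegree_modByMonic_lt _ hmonic fun h1 => by
      rw [h1] at hFd; simp at hFd; omega
  refine ⟨_, order_aevalAeval_mem he hn hco hx hy hdeg, (P.divByMonic F).aevalAeval x y,
    hrange ⟨_, rfl⟩, ?_⟩
  have hFe : F.aevalAeval x y = y ^ n - x ^ m := by simp [hF]
  rw [← hFe, ← map_mul, ← map_add, Polynomial.modByMonic_add_div]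
  exact hd

/-- The values of functions up to the value of the approximate equation. -/
lemma mem_pairSemigroup_or {x y : PowerSeries ℂ} {e n m : ℕ} (he : e ≠ 0) (hn : n ≠ 0)
    (hco : n.Coprime m) (hx : x.order = (e * n : ℕ)) (hy : y.order = (e * m : ℕ)) {k : ℕ}
    (hk : k ∈ orders (curveRing x y)) : k ∈ pairSemigroup (e * n) (e * m) ∨
      ∃ g ∈ orders (curveRing x y), ((y ^ n - x ^ m).order + g = k ∨
        ∃ l ∈ pairSemigroup (e * n) (e * m), (y ^ n - x ^ m).order + g = l ∧ l < k) := by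
  obtain ⟨h, hh, hk⟩ := hk
  obtain ⟨r, hr, q, hq, hd⟩ := exists_remainder he hn hco hx hy hh (k + 1)
  have h1 := order_eq_of_X_pow_dvd_sub hk (Nat.lt_succ_self k) hd
  set f := y ^ n - x ^ m with hf
  have hq_top : (f * q).order ≠ ⊤ → ∃ g ∈ orders (curveRing x y),
      (f * q).order = f.order + g := by
    intro ht
    rw [order_mul] at ht ⊢
    obtain ⟨g, hg⟩ := ENat.ne_top_iff_exists.1 (fun h : q.order = ⊤ => ht (by rw [h]; simp))
    exact ⟨g, ⟨q, hq, hg.symm⟩, by rw [hg]⟩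
  rcases hr with rfl | ⟨l, hl, hrl⟩
  · rw [zero_add] at h1
    obtain ⟨g, hg, hfg⟩ := hq_top (by rw [h1]; simp)
    exact Or.inr ⟨g, hg, Or.inl (by rw [← hfg, h1])⟩
  · by_cases heq : r.order = (f * q).order
    · obtain ⟨g, hg, hfg⟩ := hq_top (by rw [← heq, hrl]; simp)
      have hle := min_order_le_order_add r (f * q)
      rw [h1, heq, min_self, ← heq, hrl] at hle
      norm_cast at hle
      rcases eq_or_lt_of_le hle with h2 | h2
      · exact Or.inl (h2 ▸ hl)
      · exact Or.inr ⟨g, hg, Or.inr ⟨l, hl, by rw [← hfg, ← heq, hrl], h2⟩⟩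
    · rw [order_add_of_order_ne _ _ heq] at h1
      rcases min_choice r.order (f * q).order with h2 | h2
      · rw [h2, hrl] at h1
        norm_cast at h1
        exact Or.inl (h1 ▸ hl)
      · obtain ⟨g, hg, hfg⟩ := hq_top (by rw [← h2, h1]; simp)
        exact Or.inr ⟨g, hg, Or.inl (by rw [← hfg, ← h2, h1])⟩

/-! ### Normal forms of parametrizations -/

lemma HasLead.constantCoeff_eq_zero {h : PowerSeries ℂ} {k : ℕ} {c : ℂ} (hh : HasLead h k c)
    (hk : 0 < k) : constantCoeff h = 0 := by
  obtain ⟨u, rfl, rfl⟩ := hh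
  simp [hk.ne']

lemma hasLead_eta {n m : ℕ} {x y : PowerSeries ℂ} (hx : HasLead x n 1) (hy : HasLead y m 1) :
    HasLead (eta n m x y) (n + m) 0 := by
  have h1 := ((HasLead.natCast m).mul hy).mul hx.eulerD
  have h2 := ((HasLead.natCast n).mul hx).mul hy.eulerD
  rw [show 0 + m + n = n + m by ring] at h1
  rw [zero_add] at h2
  have h3 := h1.sub h2
  rwa [show (m : ℂ) * 1 * (n * 1) - n * 1 * (m * 1) = 0 by ring] at h3

/-- The values of `η` and of the approximate equation `f = y ^ n - x ^ m` determine each other,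
because of the identity `e (x df - m f dx) = - y ^ (n - 1) η`. -/
lemma order_approx_add {x y : PowerSeries ℂ} {e n m : ℕ} (he : e ≠ 0) (hn : n ≠ 0) (hm : m ≠ 0)
    (hx : HasLead x (e * n) 1) (hy : HasLead y (e * m) 1) :
    (y ^ n - x ^ m).order + (e * n : ℕ) =
      ((n - 1) * (e * m) : ℕ) + (eta (e * n) (e * m) x y).order := by
  set f := y ^ n - x ^ m with hf
  have hid : (e : PowerSeries ℂ) * (x * eulerD f - m * f * eulerD x) =
      - (y ^ (n - 1) * eta (e * n) (e * m) x y) := by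
    obtain ⟨n, rfl⟩ := Nat.exists_eq_succ_of_ne_zero hn
    obtain ⟨m, rfl⟩ := Nat.exists_eq_succ_of_ne_zero hm
    rw [hf, eta, map_sub, Derivation.leibniz_pow, Derivation.leibniz_pow]
    simp only [smul_eq_mul, nsmul_eq_mul, Nat.succ_eq_add_one, add_tsub_cancel_right]
    push_cast
    ring
  have hyo : (y ^ (n - 1)).order = ((n - 1) * (e * m) : ℕ) := by
    rw [order_pow, hy.order_eq one_ne_zero]
    simp [nsmul_eq_mul]
  by_cases hf0 : f = 0
  · rw [hf0] at hid
    have : eta (e * n) (e * m) x y = 0 := by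
      have h0 : y ^ (n - 1) * eta (e * n) (e * m) x y = 0 := by
        rw [← neg_eq_zero, ← hid]; simp
      refine (mul_eq_zero.1 h0).resolve_left fun h => ?_
      rw [h, order_zero] at hyo
      exact ENat.top_ne_natCast _ hyo
    rw [hf0, this]
    simp
  obtain ⟨w, hw⟩ := ENat.ne_top_iff_exists.1 (order_finite_iff_ne_zero.2 hf0).ne
  obtain ⟨c, hc, hl⟩ := exists_hasLead_of_order_eq hw.symm
  have hwlt : n * (e * m) < w := by
    have h1 := hx.pow m
    rw [show m * (e * n) = n * (e * m) by ring] at h1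
    have h2 := (hy.pow n).sub h1
    rw [one_pow, one_pow, sub_self] at h2
    obtain ⟨d, h3⟩ := h2.succ
    have := h3.le_order
    rw [← hf, ← hw] at this
    exact_mod_cast this
  have h1 := hx.mul hl.eulerD
  have h2 := ((HasLead.natCast m).mul hl).mul hx.eulerD
  rw [show 0 + w + e * n = e * n + w by ring] at h2
  have h3 := (HasLead.natCast e).mul (h1.sub h2)
  rw [hid] at h3
  have h4 := h3.order_eq ?_
  · rw [order_neg, order_mul, hyo] at h4
    rw [h4, ← hw]
    push_cast
    ring
  · have hwne : (w : ℂ) - n * (e * m) ≠ 0 := by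
      rw [sub_ne_zero]
      exact_mod_cast hwlt.ne'
    have : (e : ℂ) * (1 * (w * c) - m * c * ((e * n : ℕ) * 1)) = e * c * (w - n * (e * m)) := by
      push_cast; ring
    rw [this]
    exact mul_ne_zero (mul_ne_zero (by exact_mod_cast he) hc) hwne

lemma exists_raise_eta_aux {n m : ℕ} (hm : 0 < m) {x y : PowerSeries ℂ} {c : ℂ}
    {i j : ℕ} (hx : HasLead x n 1) (hy : HasLead y m 1)
    (hc : HasLead (eta n m x y) (i * n + j * m) c) (hj : 2 ≤ j) (hlt : n + m < i * n + j * m) :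
    ∃ x', curveRing x' y = curveRing x y ∧ HasLead x' n 1 ∧
      HasLead (eta n m x' y) (i * n + j * m) 0 := by
  obtain ⟨j, rfl⟩ := Nat.exists_eq_add_of_le' hj
  set k := (j + 1) * m + i * n with hk
  have hkm : i * n + (j + 2) * m = m + k := by rw [hk]; ring
  rw [hkm] at hc hlt ⊢
  have hnk : n < k := by omega
  have hp : HasLead (y ^ (j + 1) * x ^ i) k 1 := by
    simpa using (hy.pow (j + 1)).mul (hx.pow i)
  set p := y ^ (j + 1) * x ^ i with hpdef
  have hden : (m : ℂ) * (k - n) ≠ 0 := by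
    refine mul_ne_zero (by exact_mod_cast hm.ne') (sub_ne_zero.2 ?_)
    exact_mod_cast hnk.ne'
  have hlead : HasLead (m * y * eulerD p - n * p * eulerD y) (m + k) (m * (k - n)) := by
    have h1 := ((HasLead.natCast m).mul hy).mul hp.eulerD
    have h2 := ((HasLead.natCast n).mul hp).mul hy.eulerD
    rw [show 0 + k + m = 0 + m + k by ring] at h2
    have := h1.sub h2
    rw [zero_add] at this
    convert this using 1
    ring
  set a : ℂ := - c / (m * (k - n)) with ha
  refine ⟨x + C a * p, curveRing_change (hy.constantCoeff_eq_zero hm) a (by omega), ?_, ?_⟩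
  · have h1 := (HasLead.const a).mul (hp.of_lt hnk)
    rw [zero_add] at h1
    simpa using hx.add h1
  · have heq : eta n m (x + C a * p) y =
        eta n m x y + C a * (m * y * eulerD p - n * p * eulerD y) := by
      rw [eta, eta, map_add, Derivation.leibniz, eulerD_C]
      simp only [smul_eq_mul]
      ring
    rw [heq]
    have h := (HasLead.const a).mul hlead
    rw [zero_add] at h
    convert hc.add h using 1
    rw [ha, div_mul_cancel₀ _ hden, add_neg_cancel]

/-- If the value of `η` lies in the semigroup generated by the orders `n`, `m` of `x`, `y`, then it
can be increased by a change of coordinates that preserves `n` and `m`. -/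
lemma exists_raise_eta {n m : ℕ} (hn : 0 < n) (hm : 0 < m) {x y : PowerSeries ℂ} {k : ℕ}
    (hx : HasLead x n 1) (hy : HasLead y m 1) (hk : X ^ k ∣ eta n m x y)
    (hmem : k ∈ pairSemigroup n m) (hlt : n + m < k) :
    ∃ x' y', curveRing x' y' = curveRing x y ∧ HasLead x' n 1 ∧ HasLead y' m 1 ∧
      X ^ (k + 1) ∣ eta n m x' y' := by
  obtain ⟨i, j, rfl⟩ := hmem
  obtain ⟨c, hc⟩ := hasLead_of_X_pow_dvd hk
  by_cases hj : 2 ≤ j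
  · obtain ⟨x', hO, hx', hl⟩ := exists_raise_eta_aux hm hx hy hc hj hlt
    obtain ⟨d, hd⟩ := hl.succ
    exact ⟨x', y, hO, hx', hy, hd.X_pow_dvd⟩
  · have hi : 2 ≤ i := by
      by_contra hi
      have h1 : i * n ≤ n := by nlinarith
      have h2 : j * m ≤ m := by nlinarith
      omega
    have hc' := HasLead.const (-1) |>.mul hc
    rw [show C (-1) * eta n m x y = eta m n y x by rw [eta_swap]; simp, zero_add,
      add_comm] at hc'
    obtain ⟨y', hO, hy', hl⟩ := exists_raise_eta_aux hn hy hx hc' hi (by omega)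
    obtain ⟨d, hd⟩ := hl.succ
    refine ⟨x, y', ?_, hx, hy', ?_⟩
    · rw [curveRing_comm, hO, curveRing_comm]
    · have := hd.X_pow_dvd
      rw [eta_swap, dvd_neg, add_comm (j * m)] at this
      exact this

/-- Coordinates can be chosen so that the value of `η` is not in the semigroup generated by the
orders `n`, `m` of the coordinates, or is as large as desired. -/
lemma exists_coordinates_eta {n m : ℕ} (hn : 0 < n) (hm : 0 < m) {x y : PowerSeries ℂ}
    (hx : HasLead x n 1) (hy : HasLead y m 1) (N : ℕ) :
    ∃ x' y', curveRing x' y' = curveRing x y ∧ HasLead x' n 1 ∧ HasLead y' m 1 ∧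
      ((∃ l : ℕ, l ∉ pairSemigroup n m ∧ n + m < l ∧ (eta n m x' y').order = l) ∨
        (N : ℕ∞) ≤ (eta n m x' y').order) := by
  induction N with
  | zero => exact ⟨x, y, rfl, hx, hy, Or.inr (by simp)⟩
  | succ N ih =>
    obtain ⟨x', y', hO, hx', hy', h | h⟩ := ih
    · exact ⟨x', y', hO, hx', hy', Or.inl h⟩
    rcases eq_or_lt_of_le h with h | h
    · have hlt : n + m < N := by
        obtain ⟨c, hc⟩ := (hasLead_eta hx' hy').succ
        have := hc.le_order
        rw [← h] at this
        exact_mod_cast this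
      by_cases hmem : N ∈ pairSemigroup n m
      · obtain ⟨x'', y'', hO', hx'', hy'', hd⟩ :=
          exists_raise_eta hn hm hx' hy' (X_pow_dvd_iff_le_order.2 h.le) hmem hlt
        exact ⟨x'', y'', hO'.trans hO, hx'', hy'', Or.inr (X_pow_dvd_iff_le_order.1 hd)⟩
      · exact ⟨x', y', hO, hx', hy', Or.inl ⟨N, hmem, hlt, h.symm⟩⟩
    · refine ⟨x', y', hO, hx', hy', Or.inr ?_⟩
      push_cast
      exact Order.add_one_le_of_lt h

lemma curveRing_C_mul {x y : PowerSeries ℂ} {a : ℂ} (ha : a ≠ 0) :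
    curveRing (C a * x) y = curveRing x y := by
  apply le_antisymm
  · exact curveRing_le (mul_mem (C_mem _ _) (left_mem_curveRing _ _)) (right_mem_curveRing _ _)
  · refine curveRing_le ?_ (right_mem_curveRing _ _)
    have : x = C a⁻¹ * (C a * x) := by
      rw [← mul_assoc, ← map_mul, inv_mul_cancel₀ ha, map_one, one_mul]
    have hmem := mul_mem (C_mem _ a⁻¹) (left_mem_curveRing (C a * x) y)
    rwa [← this] at hmem

lemma exists_normalize {x y : PowerSeries ℂ} {n : ℕ} (hx : x.order = n) :
    ∃ x', curveRing x' y = curveRing x y ∧ HasLead x' n 1 := by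
  obtain ⟨c, hc, hl⟩ := exists_hasLead_of_order_eq hx
  refine ⟨C c⁻¹ * x, curveRing_C_mul (inv_ne_zero hc), ?_⟩
  have := (HasLead.const c⁻¹).mul hl
  rwa [zero_add, inv_mul_cancel₀ hc] at this

/-- Subtracting a polynomial in `x` from `y` makes the order of `y` a number that is not a
multiple of `n`, or as large as desired. -/
lemma exists_reduce {x y : PowerSeries ℂ} {n : ℕ} (hn : 0 < n) (hx : HasLead x n 1)
    (hy : (n : ℕ∞) ≤ y.order) (N : ℕ) : ∃ y', curveRing x y' = curveRing x y ∧
      (n : ℕ∞) ≤ y'.order ∧ ((∃ m : ℕ, y'.order = m ∧ ¬ n ∣ m) ∨ (N : ℕ∞) ≤ y'.order) := by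
  induction N with
  | zero => exact ⟨y, rfl, hy, Or.inr (by simp)⟩
  | succ N ih =>
    obtain ⟨y', hO, hn', h | h⟩ := ih
    · exact ⟨y', hO, hn', Or.inl h⟩
    rcases eq_or_lt_of_le h with h | h
    · by_cases hd : n ∣ N
      · obtain ⟨k, rfl⟩ := hd
        obtain ⟨c, -, hc⟩ := exists_hasLead_of_order_eq h.symm
        rw [← h] at hn'
        have hk : 1 ≤ k := by
          by_contra hk
          have : k = 0 := by omega
          subst this
          norm_cast at hn'
          omega
        have hl := (HasLead.const (-c)).mul (hx.pow k)
        rw [zero_add, mul_comm k n, one_pow, mul_one] at hl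
        have hl' := hc.add hl
        rw [add_neg_cancel] at hl'
        obtain ⟨d, hd⟩ := hl'.succ
        have ho := hd.le_order
        refine ⟨y' + C (-c) * x ^ k, ?_, ?_, Or.inr ho⟩
        · have := curveRing_change (x := y') (hx.constantCoeff_eq_zero hn) (-c) (i := 0) hk
          rw [pow_zero, mul_one] at this
          rw [curveRing_comm, this, curveRing_comm, hO]
        · refine hn'.trans (le_trans ?_ ho)
          exact_mod_cast Nat.le_succ _
      · exact ⟨y', hO, hn', Or.inl ⟨N, h.symm, hd⟩⟩
    · refine ⟨y', hO, hn', Or.inr ?_⟩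
      push_cast
      exact Order.add_one_le_of_lt h

/-- If `y` vanishes to high order then the ring of the curve has only values divisible by the
order of `x`, up to this order. -/
lemma dvd_of_mem_orders {x y : PowerSeries ℂ} {n k N : ℕ} (hn : n ≠ 0) (hx : x.order = n)
    (hy : (N : ℕ∞) ≤ y.order) (hk : k ∈ orders (curveRing x y)) (hkN : k < N) : n ∣ k := by
  obtain ⟨h, hh, hk⟩ := hk
  obtain ⟨a, ha, hd⟩ := hh N
  have key : ∃ p : Polynomial ℂ, X ^ N ∣ a - Polynomial.aeval x p := by
    clear hd
    induction ha using Algebra.adjoin_induction with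
    | mem z hz =>
      rcases hz with rfl | rfl
      · exact ⟨Polynomial.X, by simp⟩
      · exact ⟨0, by simpa using X_pow_dvd_iff_le_order.2 hy⟩
    | algebraMap r => exact ⟨Polynomial.C r, by simp⟩
    | add u v _ _ hu hv =>
      obtain ⟨p, hp⟩ := hu
      obtain ⟨q, hq⟩ := hv
      exact ⟨p + q, by rw [map_add, add_sub_add_comm]; exact dvd_add hp hq⟩
    | mul u v _ _ hu hv =>
      obtain ⟨p, hp⟩ := hu
      obtain ⟨q, hq⟩ := hv
      refine ⟨p * q, ?_⟩
      have : u * v - Polynomial.aeval x (p * q) = (u - Polynomial.aeval x p) * v +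
          Polynomial.aeval x p * (v - Polynomial.aeval x q) := by rw [map_mul]; ring
      rw [this]
      exact dvd_add (hp.mul_right _) (hq.mul_left _)
  obtain ⟨p, hp⟩ := key
  have h1 := order_eq_of_X_pow_dvd_sub hk hkN (by simpa using dvd_add hd hp)
  by_cases hp0 : p = 0
  · rw [hp0, map_zero, order_zero] at h1
    exact absurd h1 (ENat.top_ne_natCast _)
  obtain ⟨i, hi⟩ := order_aeval hn hx hp0
  rw [h1] at hi
  norm_cast at hi
  exact hi ▸ dvd_mul_left n i

/-- Coordinates of a singular branch: `x` of minimal order `n ≥ 2`, and `y` of an order `m > n` that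
is not a multiple of `n`. -/
lemma exists_coordinates {x y : PowerSeries ℂ} (hx : (2 : ℕ∞) ≤ x.order)
    (hy : (2 : ℕ∞) ≤ y.order)
    (hgcd : ∀ d : ℕ, 2 ≤ d → ∃ k ∈ orders (curveRing x y), ¬ d ∣ k) :
    ∃ n m : ℕ, 2 ≤ n ∧ n < m ∧ ¬ n ∣ m ∧ ∃ x' y', curveRing x' y' = curveRing x y ∧
      HasLead x' n 1 ∧ HasLead y' m 1 := by
  wlog hxy : x.order ≤ y.order generalizing x y
  · rw [curveRing_comm] at hgcd ⊢
    exact this hy hx hgcd (le_of_not_ge hxy)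
  have htop : x.order ≠ ⊤ := by
    intro ht
    rw [ht, top_le_iff] at hxy
    obtain ⟨k, ⟨h, hh, hk⟩, hkd⟩ := hgcd 2 le_rfl
    obtain ⟨a, ha, hd⟩ := hh (k + 1)
    rw [order_eq_top.1 ht, order_eq_top.1 hxy] at ha
    have hbot : a ∈ (⊥ : Subalgebra ℂ (PowerSeries ℂ)) :=
      (Algebra.adjoin_le (by rintro z (rfl | rfl) <;> exact zero_mem _)) ha
    obtain ⟨c, rfl⟩ := Algebra.mem_bot.1 hbot
    have h1 := order_eq_of_X_pow_dvd_sub hk (Nat.lt_succ_self k) hd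
    have h2 : algebraMap ℂ (PowerSeries ℂ) c = C c := rfl
    rw [h2] at h1
    by_cases hc : c = 0
    · rw [hc, map_zero, order_zero] at h1
      exact absurd h1 (ENat.top_ne_natCast _)
    · rw [(HasLead.const c).order_eq hc] at h1
      norm_cast at h1
      exact hkd (h1 ▸ dvd_zero 2)
  obtain ⟨n, hn⟩ := ENat.ne_top_iff_exists.1 htop
  rw [← hn] at hx hxy
  have hn2 : 2 ≤ n := by exact_mod_cast hx
  obtain ⟨x₁, hO₁, hx₁⟩ := exists_normalize (y := y) hn.symm
  obtain ⟨k, hk, hkd⟩ := hgcd n hn2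
  obtain ⟨y₁, hO₂, hn₁, ⟨m, hm, hnm⟩ | h⟩ := exists_reduce (by omega) hx₁ hxy (k + 1)
  · obtain ⟨y₂, hO₃, hy₂⟩ := exists_normalize (y := x₁) hm
    refine ⟨n, m, hn2, ?_, hnm, x₁, y₂, ?_, hx₁, hy₂⟩
    · rw [hm] at hn₁
      refine lt_of_le_of_ne (by exact_mod_cast hn₁) ?_
      rintro rfl
      exact hnm dvd_rfl
    · rw [curveRing_comm, hO₃, curveRing_comm, hO₂, hO₁]
  · exfalso
    refine hkd (dvd_of_mem_orders (by omega) (hx₁.order_eq one_ne_zero) h ?_ (Nat.lt_succ_self k))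
    rwa [hO₂, hO₁]

/-! ### The first value of a form that is not a value of a function -/

/-- `l` is the least element of `Λ \ Γ`, and every element of `Λ` outside `Γ` and `l + Γ` is larger
than some element of `Γ ∩ (l + Γ)`. -/
structure IsFirstFormValue (Γ Λ : Set ℕ) (l : ℕ) : Prop where
  mem : l ∈ Λ
  notMem : l ∉ Γ
  mem_of_lt : ∀ k ∈ Λ, k < l → k ∈ Γ
  syzygy : ∀ k ∈ Λ, k ∈ Γ ∨ (∃ g ∈ Γ, k = l + g) ∨ ∃ g ∈ Γ, l + g ∈ Γ ∧ l + g < k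

lemma isFirstFormValue_of_order_eta {n m : ℕ} (hn : n ≠ 0) (hm : m ≠ 0) {x y : PowerSeries ℂ}
    {l : ℕ} (hl : (eta n m x y).order = l) (hmem : l ∉ orders (curveRing x y)) :
    IsFirstFormValue (orders (curveRing x y)) (formOrders (curveRing x y)) l where
  mem := ⟨_, eta_mem_forms n m x y, hl⟩
  notMem := hmem
  mem_of_lt k hk hkl := mem_orders_of_lt_order_eta hn hm hk (by rw [hl]; exact_mod_cast hkl)
  syzygy _ hk := mem_orders_or_of_order_eta hn hm hk hl

lemma mem_pairSemigroup_or_of_coprime {n m : ℕ} (hn : 0 < n) (hco : n.Coprime m) (k : ℕ) :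
    k ∈ pairSemigroup n m ∨ ∃ a b, 1 ≤ a ∧ 1 ≤ b ∧ k + a * n + b * m = n * m := by
  obtain ⟨j, hjn, hj⟩ := Nat.exists_mul_mod_eq_of_coprime k hco.symm hn.ne'
  have hmod : j * m ≡ k [MOD n] := by rw [mul_comm]; exact hj
  rcases le_or_gt (j * m) k with h | h
  · obtain ⟨i, hi⟩ := (Nat.modEq_iff_dvd' h).1 hmod
    exact Or.inl ⟨i, j, by rw [mul_comm i n]; omega⟩
  · obtain ⟨a, ha⟩ := (Nat.modEq_iff_dvd' h.le).1 hmod.symm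
    refine Or.inr ⟨a, n - j, ?_, by omega, ?_⟩
    · rcases Nat.eq_zero_or_pos a with rfl | h'
      · omega
      · exact h'
    · obtain ⟨b, rfl⟩ := Nat.exists_eq_add_of_lt hjn
      have : j + b + 1 - j = b + 1 := by omega
      rw [this]
      have : j * m = k + (j + b + 1) * a := by omega
      linarith [this, mul_comm a (j + b + 1), add_mul (j + b) 1 m, add_mul j b m,
        add_mul b 1 m]

lemma notMem_pairSemigroup {n m : ℕ} (hco : n.Coprime m) {k a b : ℕ} (ha : 1 ≤ a)
    (hb : 1 ≤ b) (hn : 0 < n) (h : k + a * n + b * m = n * m) : k ∉ pairSemigroup n m := by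
  rintro ⟨i, j, rfl⟩
  have h1 : (i + a) * n + (j + b) * m = n * m := by linarith
  have h2 : n ∣ (j + b) * m :=
    (Nat.dvd_add_right (dvd_mul_left n (i + a))).1 (h1 ▸ dvd_mul_right n m)
  have h3 := Nat.le_of_dvd (by omega) (hco.dvd_of_dvd_mul_right h2)
  have h4 := Nat.mul_le_mul_right m h3
  have h5 : 0 < (i + a) * n := by positivity
  omega

lemma dvd_of_mem_pairSemigroup {d n m k : ℕ} (hn : d ∣ n) (hm : d ∣ m)
    (hk : k ∈ pairSemigroup n m) : d ∣ k := by
  obtain ⟨i, j, rfl⟩ := hk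
  exact dvd_add (hn.mul_left _) (hm.mul_left _)

/-- The semigroup data of a singular branch, for functions (`Γ`) and for forms (`Λ`). Either the
two smallest generators `n`, `m` are coprime, or there is a first value `l` of forms that is not in
`Γ`; in the latter case `w = l + (n / gcd n m - 1) m - n` is the value of the approximate
equation. -/
structure BranchValues (Γ Λ : Set ℕ) (n m : ℕ) : Prop where
  zero_mem : 0 ∈ Γ
  add_mem : ∀ k ∈ Γ, ∀ l ∈ Γ, k + l ∈ Γ
  forms_of_mem : ∀ k ∈ Γ, k ≠ 0 → k ∈ Λ
  forms_add : ∀ k ∈ Γ, ∀ l ∈ Λ, k + l ∈ Λ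
  two_le : 2 ≤ n
  lt : n < m
  not_dvd : ¬ n ∣ m
  left_mem : n ∈ Γ
  right_mem : m ∈ Γ
  dvd_of_lt : ∀ k ∈ Γ, k < m → n ∣ k
  gcd_eq_one : ∀ d : ℕ, 2 ≤ d → ∃ k ∈ Γ, ¬ d ∣ k
  cases : (n.Coprime m ∧ Γ = pairSemigroup n m ∧ (Λ ⊆ Γ ∨ ∃ l, IsFirstFormValue Γ Λ l)) ∨
    (2 ≤ n.gcd m ∧ ∃ l w, IsFirstFormValue Γ Λ l ∧ l ∉ pairSemigroup n m ∧ n + m < l ∧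
      w + n = (n / n.gcd m - 1) * m + l ∧ w ∈ Γ ∧
      ∀ k ∈ Γ, k ∈ pairSemigroup n m ∨
        ∃ g ∈ Γ, w + g = k ∨ (w + g ∈ pairSemigroup n m ∧ w + g < k))

lemma exists_branchValues {x y : PowerSeries ℂ} (hx : (2 : ℕ∞) ≤ x.order)
    (hy : (2 : ℕ∞) ≤ y.order)
    (hgcd : ∀ d : ℕ, 2 ≤ d → ∃ k ∈ orders (curveRing x y), ¬ d ∣ k) :
    ∃ n m, BranchValues (orders (curveRing x y)) (formOrders (curveRing x y)) n m := by
  obtain ⟨n, m, hn2, hlt, hnm, x₀, y₀, hO₀, hx₀, hy₀⟩ := exists_coordinates hx hy hgcd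
  refine ⟨n, m, ?_⟩
  rw [← hO₀] at hgcd ⊢
  clear hO₀ hx hy x y
  have hn0 : 0 < n := by omega
  have hm0 : 0 < m := by omega
  have hxo := hx₀.order_eq one_ne_zero
  have hyo := hy₀.order_eq one_ne_zero
  have hnΓ : n ∈ orders (curveRing x₀ y₀) := ⟨x₀, left_mem_curveRing _ _, hxo⟩
  have hmΓ : m ∈ orders (curveRing x₀ y₀) := ⟨y₀, right_mem_curveRing _ _, hyo⟩
  refine ⟨zero_mem_orders, fun k hk l hl => add_mem_orders hk hl,
    fun k => mem_formOrders_of_mem_orders, fun k hk l hl => add_mem_formOrders hk hl, hn2, hlt,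
    hnm, hnΓ, hmΓ, fun k hk hkm => dvd_of_mem_orders hn0.ne' hxo hyo.ge hk hkm, hgcd, ?_⟩
  obtain ⟨n', m', hco, hn', hm'⟩ := Nat.exists_coprime n m
  set e := n.gcd m with he
  have he0 : 0 < e := Nat.gcd_pos_of_pos_left _ hn0
  rw [mul_comm] at hn' hm'
  have hn'0 : n' ≠ 0 := by rintro rfl; omega
  have hm'0 : m' ≠ 0 := by rintro rfl; omega
  have hdiv : n / e = n' := by rw [hn', Nat.mul_div_cancel_left _ he0]
  -- For `e ≥ 2`, a value `k₁` not divisible by `e` bounds the order of the approximate equation, and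
  -- so the value of `η`. For `e = 1`, all integers from `n m` on are values.
  obtain ⟨k₁, hk₁, hek₁⟩ : ∃ k ∈ orders (curveRing x₀ y₀), 2 ≤ e → ¬ e ∣ k := by
    by_cases he2 : 2 ≤ e
    · exact (hgcd e he2).imp fun k hk => ⟨hk.1, fun _ => hk.2⟩
    · exact ⟨0, zero_mem_orders, fun h => absurd h he2⟩
  obtain ⟨x, y, hO, hx, hy, hη⟩ := exists_coordinates_eta hn0 hm0 hx₀ hy₀ (k₁ + n * m + n + 1)
  rw [← hO] at hnΓ hmΓ hk₁ ⊢
  have hF := order_approx_add (x := x) (y := y) he0.ne' hn'0 hm'0 (hn' ▸ hx) (hm' ▸ hy)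
  have hval := fun k => mem_pairSemigroup_or (x := x) (y := y) (k := k) he0.ne' hn'0 hco
    (hn' ▸ hx.order_eq one_ne_zero) (hm' ▸ hy.order_eq one_ne_zero)
  rw [← hn', ← hm'] at hF hval
  set f := y ^ n' - x ^ m' with hf
  have hfO : f ∈ curveRing x y := sub_mem (pow_mem (right_mem_curveRing _ _) _)
    (pow_mem (left_mem_curveRing _ _) _)
  have hη0 : ((n + m : ℕ) : ℕ∞) ≤ (eta n m x y).order := (hasLead_eta hx hy).le_order
  have hval' : ∀ k ∈ orders (curveRing x y), (k : ℕ∞) < f.order → k ∈ pairSemigroup n m := by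
    intro k hk hkf
    rcases hval k hk with h | ⟨g, -, h | ⟨l, -, h, hlk⟩⟩
    · exact h
    · exact absurd (h ▸ le_self_add : f.order ≤ k) (not_le.2 hkf)
    · have h1 : f.order ≤ l := h ▸ le_self_add
      exact absurd (h1.trans (by exact_mod_cast hlk.le)) (not_le.2 hkf)
  have hsub : pairSemigroup n m ⊆ orders (curveRing x y) := by
    rintro k ⟨i, j, rfl⟩
    refine ⟨x ^ i * y ^ j, mul_mem (pow_mem (left_mem_curveRing _ _) _)
      (pow_mem (right_mem_curveRing _ _) _), ?_⟩
    rw [order_mul, order_pow, order_pow, hx.order_eq one_ne_zero, hy.order_eq one_ne_zero]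
    simp [nsmul_eq_mul]
  by_cases he1 : e = 1
  · left
    rw [he1, one_mul] at hn' hm'
    subst hn' hm'
    have hbig : ∀ k, n * m ≤ k → k ∈ pairSemigroup n m := by
      intro k hk
      rcases mem_pairSemigroup_or_of_coprime hn0 hco k with h | ⟨a, b, ha, hb, hab⟩
      · exact h
      · have : 0 < a * n := by positivity
        omega
    have hfo : ((n * m : ℕ) : ℕ∞) ≤ f.order := by
      have h1 : ((n * m : ℕ) : ℕ∞) + (n : ℕ) ≤ f.order + (n : ℕ) := by
        rw [hF]
        refine le_trans ?_ (add_le_add_right hη0 _)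
        obtain ⟨p, rfl⟩ := Nat.exists_eq_add_of_le' hn0
        norm_cast
        simp only [add_tsub_cancel_right]
        linarith [add_mul p 1 m]
      exact (ENat.add_le_add_iff_right (ENat.natCast_ne_top n)).1 h1
    have hΓ : orders (curveRing x y) = pairSemigroup n m := by
      refine Set.Subset.antisymm (fun k hk => ?_) hsub
      rcases lt_or_ge k (n * m) with h | h
      · exact hval' k hk (lt_of_lt_of_le (by exact_mod_cast h) hfo)
      · exact hbig k h
    refine ⟨hco, hΓ, ?_⟩
    rcases hη with ⟨l, hl, -, hlo⟩ | hη
    · exact Or.inr ⟨l, isFirstFormValue_of_order_eta hn0.ne' hm0.ne' hlo (hΓ ▸ hl)⟩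
    · left
      intro k hk
      rcases lt_or_ge k (n * m) with h | h
      · refine mem_orders_of_lt_order_eta hn0.ne' hm0.ne' hk (lt_of_lt_of_le ?_ hη)
        norm_cast
        omega
      · exact hsub (hbig k h)
  · right
    have he2 : 2 ≤ e := by omega
    have hn'2 : 2 ≤ n' := by
      by_contra h
      have h1 : n' = 1 := by omega
      rw [h1, mul_one] at hn'
      exact hnm (by rw [hn', hm']; exact dvd_mul_right _ _)
    have hm1 : m ≤ (n' - 1) * m := Nat.le_mul_of_pos_left m (by omega)
    rcases hη with ⟨l, hl, hnml, hlo⟩ | hη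
    · rw [hlo] at hF
      have hftop : f.order ≠ ⊤ := by
        intro h
        rw [h, top_add] at hF
        exact ENat.top_ne_natCast _ (by exact_mod_cast hF)
      obtain ⟨w, hw⟩ := ENat.ne_top_iff_exists.1 hftop
      rw [← hw] at hF hval hval'
      norm_cast at hF
      refine ⟨he2, l, w, isFirstFormValue_of_order_eta hn0.ne' hm0.ne' hlo fun h => ?_, hl, hnml,
        by rw [hdiv]; exact hF, ⟨f, hfO, hw.symm⟩, fun k hk => ?_⟩
      · exact hl (hval' l h (by norm_cast; omega))
      · refine (hval k hk).imp_right ?_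
        rintro ⟨g, hg, h | ⟨i, hi, h, hik⟩⟩
        · exact ⟨g, hg, Or.inl (by exact_mod_cast h)⟩
        · norm_cast at h
          exact ⟨g, hg, Or.inr ⟨h ▸ hi, h ▸ hik⟩⟩
    · exfalso
      refine hek₁ he2 (dvd_of_mem_pairSemigroup (Nat.gcd_dvd_left n m) (Nat.gcd_dvd_right n m)
        (hval' k₁ hk₁ ?_))
      have h1 : ((k₁ + 1 : ℕ) : ℕ∞) + (n : ℕ) ≤ f.order + (n : ℕ) := by
        rw [hF]
        refine le_trans ?_ (add_le_add_right hη _)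
        norm_cast
        omega
      exact lt_of_lt_of_le (by norm_cast; omega)
        ((ENat.add_le_add_iff_right (ENat.natCast_ne_top n)).1 h1)

end PlaneCurve

namespace PlaneCurve

/-! ### Combinatorics of the values of functions and forms -/

lemma iInf_eq_top_of_subset {Γ Λ : Set ℕ} (h : Λ ⊆ Γ) : ⨅ l ∈ Λ \ Γ, (l : ℕ∞) = ⊤ := by
  rw [Set.sdiff_eq_empty.2 h]
  simp

lemma IsFirstFormValue.iInf_eq {Γ Λ : Set ℕ} {l : ℕ} (h : IsFirstFormValue Γ Λ l) :
    ⨅ k ∈ Λ \ Γ, (k : ℕ∞) = l := by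
  refine le_antisymm (iInf₂_le l ⟨h.mem, h.notMem⟩) (le_iInf₂ fun k hk => ?_)
  rw [Nat.cast_le]
  by_contra hlt
  exact hk.2 (h.mem_of_lt k hk.1 (by omega))

section

variable {Γ Λ : Set ℕ} {n m : ℕ}

lemma BranchValues.le_of_mem (H : BranchValues Γ Λ n m) {k : ℕ} (hk : k ∈ Γ) (h0 : k ≠ 0) :
    n ≤ k := by
  rcases lt_or_ge k m with h | h
  · exact Nat.le_of_dvd (by omega) (H.dvd_of_lt k hk h)
  · have := H.lt
    omega

/-- For coprime `n < m`, the elements of `Γ ∩ (l + Γ)`, where `l = n m - a n - b m`, are at least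
`l + a n` or `l + b m`. -/
lemma le_of_add_mem {a b l g : ℕ} (hn : 0 < n) (hco : n.Coprime m)
    (hl : l + a * n + b * m = n * m) (hg : g ∈ pairSemigroup n m)
    (hlg : l + g ∈ pairSemigroup n m) : a * n ≤ g ∨ b * m ≤ g := by
  obtain ⟨i, j, rfl⟩ := hg
  by_cases hi : a ≤ i
  · exact Or.inl ((Nat.mul_le_mul_right n hi).trans le_self_add)
  by_cases hj : b ≤ j
  · exact Or.inr ((Nat.mul_le_mul_right m hj).trans le_add_self)
  exfalso
  obtain ⟨p, rfl⟩ := Nat.exists_eq_add_of_lt (not_le.1 hi)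
  obtain ⟨q, rfl⟩ := Nat.exists_eq_add_of_lt (not_le.1 hj)
  exact notMem_pairSemigroup hco (a := p + 1) (b := q + 1) (by omega) (by omega) hn
    (by linarith) hlg

/-- For one pair of exponents: if every integer larger than `l` is a value of a form, then `l` is
among the largest gaps of `Γ`. Otherwise there is a gap just above `l`, below the first syzygy
between `η` and the exact forms. -/
lemma BranchValues.exists_of_forall_mem (H : BranchValues Γ Λ n m) (hco : n.Coprime m)
    (hΓ : Γ = pairSemigroup n m) {l : ℕ} (hl : IsFirstFormValue Γ Λ l)
    (hall : ∀ k, l < k → k ∈ Λ) :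
    ∃ s, 1 ≤ s ∧ s ≤ m / n + 1 ∧ l + s * n + m = n * m := by
  have hn2 := H.two_le
  have hlt := H.lt
  have hn0 : 0 < n := by omega
  rcases mem_pairSemigroup_or_of_coprime hn0 hco l with h | ⟨a, b, ha, hb, hab⟩
  · exact absurd (hΓ ▸ h) hl.notMem
  -- There is no gap `k = l + r` of `Γ` with `0 < r < n`.
  have key : ∀ r x y, 1 ≤ x → 1 ≤ y → l + r + x * n + y * m = n * m → 0 < r → r < n → False := by
    intro r x y hx hy hk hr hrn
    have han : n ≤ a * n := Nat.le_mul_of_pos_left n ha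
    have hbm : m ≤ b * m := Nat.le_mul_of_pos_left m hb
    have hkΓ : l + r ∉ Γ := hΓ ▸ notMem_pairSemigroup hco hx hy hn0 hk
    rcases hl.syzygy (l + r) (hall _ (by omega)) with h | ⟨g, hg, h⟩ | ⟨g, hg, hlg, h⟩
    · exact hkΓ h
    · have := H.le_of_mem hg (by omega)
      omega
    · rcases le_of_add_mem hn0 hco hab (hΓ ▸ hg) (hΓ ▸ hlg) with h' | h' <;> omega
  have hmod : 0 < m % n := Nat.pos_of_ne_zero fun h => H.not_dvd (Nat.dvd_of_mod_eq_zero h)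
  have hmodlt : m % n < n := Nat.mod_lt _ hn0
  have hdm := Nat.div_add_mod m n
  rw [mul_comm] at hdm
  rcases eq_or_lt_of_le hb with rfl | hb2
  · refine ⟨a, ha, ?_, by linarith⟩
    by_contra hs
    obtain ⟨c, rfl⟩ := Nat.exists_eq_add_of_lt (not_le.1 hs)
    refine key (n - m % n) (c + 1) 2 (by omega) (by omega) ?_ (by omega) (by omega)
    zify [hmodlt.le] at hab hdm ⊢
    linarith
  · obtain ⟨c, rfl⟩ := Nat.exists_eq_add_of_lt hb2
    exact (key (m % n) (a + m / n) (c + 1) (ha.trans le_self_add) (by omega) (by linarith) hmod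
      hmodlt).elim

lemma BranchValues.mem_of_exists (H : BranchValues Γ Λ n m) (hco : n.Coprime m)
    (hΓ : Γ = pairSemigroup n m) {l s : ℕ} (hl : l ∈ Λ) (hs : s ≤ m / n + 1)
    (hls : l + s * n + m = n * m) {k : ℕ} (hk : l < k) : k ∈ Λ := by
  have hn0 : 0 < n := by have := H.two_le; omega
  rcases mem_pairSemigroup_or_of_coprime hn0 hco k with h | ⟨x, y, hx, hy, hxy⟩
  · exact H.forms_of_mem k (hΓ ▸ h) (by omega)
  have hsn : s * n ≤ m + n := by
    have h1 := Nat.mul_le_mul_right n hs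
    have h2 := Nat.div_mul_le_self m n
    linarith
  have hxn : n ≤ x * n := Nat.le_mul_of_pos_left n hx
  have hy1 : y = 1 := by
    by_contra h
    have : 2 * m ≤ y * m := Nat.mul_le_mul_right m (by omega)
    omega
  subst hy1
  have hxs : x ≤ s := by
    by_contra h
    have : s * n ≤ x * n := Nat.mul_le_mul_right n (by omega)
    omega
  obtain ⟨c, rfl⟩ := Nat.exists_eq_add_of_le hxs
  have hkl : k = c * n + l := by linarith
  rw [hkl]
  refine H.forms_add _ ?_ _ hl
  rw [hΓ]
  exact ⟨c, 0, by simp⟩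

/-! ### Minimal generators -/

lemma mem_closure_pair_iff {a b k : ℕ} :
    k ∈ AddSubmonoid.closure ({a, b} : Set ℕ) ↔ ∃ i j : ℕ, k = i * a + j * b := by
  simp [AddSubmonoid.mem_closure_pair, eq_comm]

lemma mem_closure_singleton_iff {a k : ℕ} :
    k ∈ AddSubmonoid.closure ({a} : Set ℕ) ↔ a ∣ k := by
  simp only [AddSubmonoid.mem_closure_singleton, smul_eq_mul, dvd_iff_exists_eq_mul_left, eq_comm]

lemma mem_closure_triple_iff {a b c k : ℕ} :
    k ∈ AddSubmonoid.closure ({a, b, c} : Set ℕ) ↔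
      ∃ i j r : ℕ, k = i * a + j * b + r * c := by
  rw [Set.insert_eq, AddSubmonoid.closure_union, AddSubmonoid.mem_sup]
  simp only [AddSubmonoid.mem_closure_singleton, mem_closure_pair_iff]
  constructor
  · rintro ⟨_, ⟨i, rfl⟩, _, ⟨j, r, rfl⟩, rfl⟩
    exact ⟨i, j, r, by simp [add_assoc]⟩
  · rintro ⟨i, j, r, rfl⟩
    exact ⟨_, ⟨i, rfl⟩, _, ⟨j, r, rfl⟩, by simp [add_assoc]⟩

lemma _root_.IsMinimalGeneratingSet.mem {S V : Set ℕ} (h : IsMinimalGeneratingSet S V) {v : ℕ}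
    (hv : v ∈ V) : v ∈ S := by
  rw [h.1]
  exact AddSubmonoid.subset_closure hv

lemma _root_.IsMinimalGeneratingSet.ne_zero {S V : Set ℕ} (h : IsMinimalGeneratingSet S V) {v : ℕ}
    (hv : v ∈ V) : v ≠ 0 := by
  rintro rfl
  exact h.2 0 hv (zero_mem _)

lemma _root_.IsMinimalGeneratingSet.not_dvd {S V : Set ℕ} (h : IsMinimalGeneratingSet S V) {v u : ℕ}
    (hv : v ∈ V) (hu : u ∈ V) (huv : u ≠ v) : ¬ u ∣ v := by
  intro hd
  refine h.2 v hv (AddSubmonoid.closure_mono (s := {u}) ?_ (mem_closure_singleton_iff.2 hd))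
  rintro _ rfl
  exact ⟨hu, huv⟩

/-- The generators `n`, `m` are determined by the semigroup: `v₀` is its least positive element
and `v₁` its least element that is not a multiple of `v₀`. -/
lemma BranchValues.eq_of_generators (H : BranchValues Γ Λ n m) {v₀ v₁ : ℕ} (h0 : v₀ ≠ 0)
    (hlt : v₀ < v₁) (hv₀ : v₀ ∈ Γ) (hv₁ : v₁ ∈ Γ) (hnd : ¬ v₀ ∣ v₁)
    (hmin : ∀ k ∈ Γ, k < v₁ → v₀ ∣ k) : v₀ = n ∧ v₁ = m := by
  have hnm := H.lt
  have hn2 := H.two_le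
  have h1 : n ≤ v₀ := H.le_of_mem hv₀ h0
  have h2 : v₀ = n := le_antisymm
    (Nat.le_of_dvd (by omega) (hmin n H.left_mem (by omega))) h1
  subst h2
  refine ⟨rfl, le_antisymm ?_ ?_⟩
  · by_contra h
    exact H.not_dvd (hmin m H.right_mem (by omega))
  · by_contra h
    exact hnd (H.dvd_of_lt v₁ hv₁ (by omega))

lemma BranchValues.eq_of_pair (H : BranchValues Γ Λ n m) {v₀ v₁ : ℕ} (hlt : v₀ < v₁)
    (hV : IsMinimalGeneratingSet Γ {v₀, v₁}) : v₀ = n ∧ v₁ = m := by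
  refine H.eq_of_generators (hV.ne_zero (by simp)) hlt (hV.mem (by simp)) (hV.mem (by simp))
    (hV.not_dvd (by simp) (by simp) hlt.ne) fun k hk hkv => ?_
  rw [hV.1] at hk
  obtain ⟨i, j, rfl⟩ := mem_closure_pair_iff.1 hk
  have hj : j = 0 := by
    by_contra hj
    have := Nat.le_mul_of_pos_left v₁ (Nat.pos_of_ne_zero hj)
    omega
  simp [hj]

lemma BranchValues.eq_of_four_six (H : BranchValues Γ Λ n m) {v₂ : ℕ} (hlt : 6 < v₂)
    (hV : IsMinimalGeneratingSet Γ {4, 6, v₂}) : n = 4 ∧ m = 6 := by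
  have := H.eq_of_generators (v₀ := 4) (v₁ := 6) (by omega) (by omega) (hV.mem (by simp))
    (hV.mem (by simp)) (by omega) fun k hk hkv => ?_
  · exact ⟨this.1.symm, this.2.symm⟩
  rw [hV.1] at hk
  obtain ⟨i, j, r, rfl⟩ := mem_closure_triple_iff.1 hk
  have hr : r = 0 := by
    by_contra hr
    have := Nat.le_mul_of_pos_left v₂ (Nat.pos_of_ne_zero hr)
    omega
  subst hr
  omega

lemma BranchValues.isMinimal_pair (H : BranchValues Γ Λ n m) (hΓ : Γ = pairSemigroup n m) :
    IsMinimalGeneratingSet Γ {n, m} := by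
  have hlt := H.lt
  have hn2 := H.two_le
  refine ⟨?_, ?_⟩
  · ext k
    rw [SetLike.mem_coe, mem_closure_pair_iff, hΓ]
    rfl
  · rintro v (rfl | rfl) hmem
    · have h1 := AddSubmonoid.closure_mono (t := {m}) (by
        rintro x ⟨rfl | rfl, hx⟩
        exacts [absurd rfl hx, rfl]) hmem
      exact absurd (Nat.le_of_dvd (by omega) (mem_closure_singleton_iff.1 h1)) (by omega)
    · have h1 := AddSubmonoid.closure_mono (t := {n}) (by
        rintro x ⟨rfl | rfl, hx⟩
        exacts [rfl, absurd rfl hx]) hmem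
      exact H.not_dvd (mem_closure_singleton_iff.1 h1)

/-! ### Several characteristic exponents -/

/-- If `gcd n m > 1` and every integer larger than `l` is a value of a form, then `n = 4` and
`m = 6`: otherwise `l + 1` or `l + 2` is a gap. -/
lemma BranchValues.eq_four_six_of_forall_mem (H : BranchValues Γ Λ n m) (he : 2 ≤ n.gcd m)
    {l w : ℕ} (hl : IsFirstFormValue Γ Λ l) (hw : w + n = (n / n.gcd m - 1) * m + l)
    (hval : ∀ k ∈ Γ, k ∈ pairSemigroup n m ∨
        ∃ g ∈ Γ, w + g = k ∨ (w + g ∈ pairSemigroup n m ∧ w + g < k))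
    (hall : ∀ k, l < k → k ∈ Λ) : n = 4 ∧ m = 6 := by
  have hlt := H.lt
  obtain ⟨n', m', hco, hn', hm'⟩ := Nat.exists_coprime n m
  set e := n.gcd m with hedef
  have hdiv : n / e = n' := by
    conv_lhs => rw [hn', Nat.mul_div_cancel _ (by omega : 0 < e)]
  rw [hdiv] at hw
  have hn'2 : 2 ≤ n' := by
    rcases Nat.lt_or_ge n' 2 with h | h
    · exfalso
      have hn2 := H.two_le
      interval_cases n'
      · omega
      · exact H.not_dvd (by rw [hn', hm', one_mul]; exact dvd_mul_left _ _)
    · exact h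
  have hnm' : n' < m' := by
    by_contra h
    have := Nat.mul_le_mul_right e (not_lt.1 h)
    omega
  obtain ⟨a, rfl⟩ := Nat.exists_eq_add_of_le' hn'2
  obtain ⟨b, rfl⟩ := Nat.exists_eq_add_of_lt hnm'
  -- `w - l` is `e` times the Frobenius number of `n'` and `m'`.
  set p := a * a + a * b + 3 * a + b with hp
  have hwl : w = l + (p + 1) * e := by
    have h1 : a + 2 - 1 = a + 1 := by omega
    rw [h1, hm', hn'] at hw
    rw [hp]
    linarith
  have hge : ∀ g ∈ Γ, g < 4 → g = 0 := by
    intro g hg hg4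
    by_contra h0
    have h1 := H.le_of_mem hg h0
    have h2 : 2 * 2 ≤ n := by
      rw [hn']
      exact Nat.mul_le_mul (by omega) he
    omega
  have key : ∀ r, 0 < r → r ≤ 2 → l + r < w → e ∣ l + r := by
    intro r hr hr2 hlw
    rcases hl.syzygy (l + r) (hall _ (by omega)) with h | ⟨g, hg, h⟩ | ⟨g, hg, hlg, h⟩
    · rcases hval _ h with h | ⟨g, -, h | h⟩
      · exact dvd_of_mem_pairSemigroup (Nat.gcd_dvd_left n m) (Nat.gcd_dvd_right n m) h
      · omega
      · omega
    · have := hge g hg (by omega)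
      omega
    · have := hge g hg (by omega)
      subst this
      exact absurd hlg hl.notMem
  have hpe : (p + 1) * e = p * e + e := by ring
  have h1 : e ∣ l + 1 := key 1 (by omega) (by omega) (by omega)
  have h2 : ¬ e ∣ l + 2 := by
    intro h
    have := (Nat.dvd_add_right h1).1 (show e ∣ (l + 1) + 1 from h)
    have := Nat.le_of_dvd (by omega) this
    omega
  have h3 : w ≤ l + 2 := by
    by_contra h
    exact h2 (key 2 (by omega) le_rfl (by omega))
  have hpe0 : p * e = 0 ∧ e = 2 := by omega
  have hp0 : p = 0 := by
    rcases Nat.mul_eq_zero.1 hpe0.1 with h | h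
    · exact h
    · omega
  have ha0 : a = 0 := by omega
  have hb0 : b = 0 := by omega
  rw [hn', hm', ha0, hb0, hpe0.2]
  simp

lemma BranchValues.forall_mem_of_four_six (H : BranchValues Γ Λ 4 6)
    {l w : ℕ} (hl : IsFirstFormValue Γ Λ l) (hl46 : l ∉ pairSemigroup 4 6) (h10 : 10 < l)
    (hw : w + 4 = 6 + l) (hwΓ : w ∈ Γ) {k : ℕ} (hk : l < k) : k ∈ Λ := by
  have heven : ∀ g, g ≠ 1 → 2 * g ∈ Γ := by
    intro g hg
    obtain ⟨i, j, hj, rfl⟩ : ∃ i j, j ≤ 1 ∧ g = 2 * i + 3 * j := by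
      rcases Nat.even_or_odd' g with ⟨c, rfl | rfl⟩
      · exact ⟨c, 0, by omega, by omega⟩
      · exact ⟨c - 1, 1, le_rfl, by omega⟩
    have h4 : ∀ i, 4 * i ∈ Γ := by
      intro i
      induction i with
      | zero => exact H.zero_mem
      | succ i ih => exact H.add_mem _ ih _ H.left_mem
    interval_cases j
    · convert h4 i using 1; ring
    · convert H.add_mem _ (h4 i) _ H.right_mem using 1; ring
  have hodd : l % 2 = 1 := by
    by_contra h
    refine hl.notMem ?_
    obtain ⟨c, rfl⟩ : ∃ c, l = 2 * c := ⟨l / 2, by omega⟩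
    exact heven c (by omega)
  rcases Nat.even_or_odd' (k - l) with ⟨c, hc | hc⟩
  · rcases Nat.lt_or_ge c 2 with h | h
    · have : k = w := by omega
      exact H.forms_of_mem k (this ▸ hwΓ) (by omega)
    · have : k = 2 * c + l := by omega
      rw [this]
      exact H.forms_add _ (heven c (by omega)) _ hl.mem
  · refine H.forms_of_mem k ?_ (by omega)
    have : k = 2 * (k / 2) := by omega
    rw [this]
    exact heven _ (by omega)

lemma BranchValues.isMinimal_four_six (H : BranchValues Γ Λ 4 6)
    {l w : ℕ} (hl46 : l ∉ pairSemigroup 4 6) (h10 : 10 < l)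
    (hw : w + 4 = 6 + l) (hwΓ : w ∈ Γ)
    (hval : ∀ k ∈ Γ, k ∈ pairSemigroup 4 6 ∨
        ∃ g ∈ Γ, w + g = k ∨ (w + g ∈ pairSemigroup 4 6 ∧ w + g < k)) :
    IsMinimalGeneratingSet Γ {4, 6, w} := by
  have heven : ∀ k, k ∈ pairSemigroup 4 6 ↔ k % 2 = 0 ∧ k ≠ 2 := by
    intro k
    constructor
    · rintro ⟨i, j, rfl⟩
      omega
    · rintro ⟨h1, h2⟩
      by_cases h4 : k % 4 = 0
      · exact ⟨k / 4, 0, by omega⟩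
      · exact ⟨(k - 6) / 4, 1, by omega⟩
  have hodd : l % 2 = 1 := by
    have := (heven l).not.1 hl46
    omega
  refine ⟨?_, ?_⟩
  · ext k
    rw [SetLike.mem_coe, mem_closure_triple_iff]
    constructor
    · intro hk
      by_cases hk46 : k ∈ pairSemigroup 4 6
      · obtain ⟨i, j, rfl⟩ := hk46
        exact ⟨i, j, 0, by simp⟩
      have hk2 : k ≠ 2 := by
        rintro rfl
        have := H.le_of_mem hk (by omega)
        omega
      have hkodd : k % 2 = 1 := by
        have := (heven k).not.1 hk46
        omega
      have hkw : w ≤ k := by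
        rcases hval k hk with h | ⟨g, -, h | h⟩
        · exact absurd h hk46
        · omega
        · omega
      -- `w + 2` is not a value: `2` is not one, and `w` is odd.
      have hkw2 : k ≠ w + 2 := by
        rintro rfl
        rcases hval _ hk with h | ⟨g, hg, h | h⟩
        · exact hk46 h
        · have := H.le_of_mem hg (by omega)
          omega
        · have hg0 : g = 0 := by
            by_contra h0
            have := H.le_of_mem hg h0
            omega
          have := (heven _).1 h.1
          omega
      obtain ⟨i, j, hij⟩ := (heven (k - w)).2 (by omega)
      exact ⟨i, j, 1, by omega⟩
    · have hmul : ∀ v ∈ Γ, ∀ i : ℕ, i * v ∈ Γ := by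
        intro v hv i
        induction i with
        | zero => simpa using H.zero_mem
        | succ i ih => rw [Nat.succ_mul]; exact H.add_mem _ ih _ hv
      rintro ⟨i, j, r, rfl⟩
      exact H.add_mem _ (H.add_mem _ (hmul 4 H.left_mem i) _ (hmul 6 H.right_mem j)) _
        (hmul w hwΓ r)
  · rintro v (rfl | rfl | rfl) hmem
    · have h1 := AddSubmonoid.closure_mono (t := {6, w}) (by
        rintro x ⟨rfl | rfl | rfl, hx⟩
        exacts [absurd rfl hx, by simp, by simp]) hmem
      obtain ⟨i, j, hij⟩ := mem_closure_pair_iff.1 h1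
      rcases Nat.eq_zero_or_pos j with rfl | hj
      · omega
      · have := Nat.le_mul_of_pos_left w hj
        omega
    · have h1 := AddSubmonoid.closure_mono (t := {4, w}) (by
        rintro x ⟨rfl | rfl | rfl, hx⟩
        exacts [by simp, absurd rfl hx, by simp]) hmem
      obtain ⟨i, j, hij⟩ := mem_closure_pair_iff.1 h1
      rcases Nat.eq_zero_or_pos j with rfl | hj
      · omega
      · have := Nat.le_mul_of_pos_left w hj
        omega
    · have h1 := AddSubmonoid.closure_mono (t := {4, 6}) (by
        rintro x ⟨rfl | rfl | rfl, hx⟩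
        exacts [by simp, by simp, absurd rfl hx]) hmem
      obtain ⟨i, j, hij⟩ := mem_closure_pair_iff.1 h1
      omega

/-- The characterization of the branches without gaps above `λ₁`, in terms of their values. -/
theorem BranchValues.gaps_eq_empty_iff (H : BranchValues Γ Λ n m) {L : ℕ∞}
    (hL : L = ⨅ l ∈ Λ \ Γ, (l : ℕ∞)) :
    {k : ℕ | L < k ∧ k ∉ Λ} = ∅ ↔
      (∃ v₀ v₁ : ℕ, v₀ < v₁ ∧ IsMinimalGeneratingSet Γ {v₀, v₁} ∧ L = ⊤) ∨
      (∃ v₀ v₁ : ℕ, v₀ < v₁ ∧ IsMinimalGeneratingSet Γ {v₀, v₁} ∧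
        ∃ s l : ℕ, 1 ≤ s ∧ s ≤ v₁ / v₀ + 1 ∧ L = (l : ℕ∞) ∧
          (l : ℤ) = ((v₀ : ℤ) - 1) * v₁ - s * v₀) ∨
      (∃ v₂ : ℕ, 6 < v₂ ∧ IsMinimalGeneratingSet Γ {4, 6, v₂}) := by
  have hlt := H.lt
  rcases H.cases with ⟨hco, hΓ, hsub | ⟨l, hl⟩⟩ | ⟨he, l, w, hl, hlnm, hnml, hw, hwΓ, hval⟩
  · -- One pair of exponents, and every value of a form is a value of a function.
    have htop : L = ⊤ := hL.trans (iInf_eq_top_of_subset hsub)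
    refine iff_of_true ?_ (Or.inl ⟨n, m, hlt, H.isMinimal_pair hΓ, htop⟩)
    simp [htop]
  · -- One pair of exponents, and `λ₁` is finite.
    have hLl : L = l := hL.trans hl.iInf_eq
    have hall : {k : ℕ | L < k ∧ k ∉ Λ} = ∅ ↔ ∀ k, l < k → k ∈ Λ := by
      simp [hLl, Set.eq_empty_iff_forall_notMem]
    rw [hall]
    constructor
    · intro h
      obtain ⟨s, hs1, hs2, hs⟩ := H.exists_of_forall_mem hco hΓ hl h
      refine Or.inr (Or.inl ⟨n, m, hlt, H.isMinimal_pair hΓ, s, l, hs1, hs2, hLl, ?_⟩)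
      zify at hs
      linarith
    · rintro (⟨v₀, v₁, hv, hV, htop⟩ | ⟨v₀, v₁, hv, hV, s, l', hs1, hs2, hl', heq⟩ | ⟨v₂, hv, hV⟩)
      · rw [hLl] at htop
        exact absurd htop (ENat.natCast_ne_top l)
      · obtain ⟨rfl, rfl⟩ := H.eq_of_pair hv hV
        rw [hLl] at hl'
        norm_cast at hl'
        subst hl'
        refine fun k hk => H.mem_of_exists hco hΓ hl.mem hs2 ?_ hk
        zify
        linarith
      · obtain ⟨rfl, rfl⟩ := H.eq_of_four_six hv hV
        exact absurd hco (by decide)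
  · -- Several pairs of exponents.
    have hLl : L = l := hL.trans hl.iInf_eq
    have hall : {k : ℕ | L < k ∧ k ∉ Λ} = ∅ ↔ ∀ k, l < k → k ∈ Λ := by
      simp [hLl, Set.eq_empty_iff_forall_notMem]
    have hpair : ∀ v₀ v₁ : ℕ, v₀ < v₁ → ¬ IsMinimalGeneratingSet Γ {v₀, v₁} := by
      intro v₀ v₁ hv hV
      obtain ⟨rfl, rfl⟩ := H.eq_of_pair hv hV
      obtain ⟨k, hk, hkd⟩ := H.gcd_eq_one _ he
      rw [hV.1] at hk
      exact hkd (dvd_of_mem_pairSemigroup (Nat.gcd_dvd_left _ _) (Nat.gcd_dvd_right _ _)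
        (mem_closure_pair_iff.1 hk))
    rw [hall]
    constructor
    · intro h
      obtain ⟨rfl, rfl⟩ := H.eq_four_six_of_forall_mem he hl hw hval h
      have hw' : w + 4 = 6 + l := by simpa using hw
      exact Or.inr (Or.inr ⟨w, by omega,
        H.isMinimal_four_six hlnm (by omega) hw' hwΓ hval⟩)
    · rintro (⟨v₀, v₁, hv, hV, -⟩ | ⟨v₀, v₁, hv, hV, -⟩ | ⟨v₂, hv, hV⟩)
      · exact absurd hV (hpair _ _ hv)
      · exact absurd hV (hpair _ _ hv)
      · obtain ⟨rfl, rfl⟩ := H.eq_of_four_six hv hV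
        intro k hk
        exact H.forall_mem_of_four_six hl hlnm (by omega) (by simpa using hw) hwΓ hk

end

/-! ### Taylor series at the origin -/

/-- The Taylor series at `0` of a function of one variable, as a formal power series. -/
noncomputable def taylor (h : ℂ → ℂ) : PowerSeries ℂ :=
  PowerSeries.mk fun k => iteratedDeriv k h 0 / k.factorial

section taylor

open PowerSeries

variable {h g : ℂ → ℂ}

lemma coeff_taylor (h : ℂ → ℂ) (k : ℕ) : coeff k (taylor h) = iteratedDeriv k h 0 / k.factorial :=
  coeff_mk _ _

lemma X_pow_dvd_taylor_iff (hh : AnalyticAt ℂ h 0) {N : ℕ} :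
    X ^ N ∣ taylor h ↔ (N : ℕ∞) ≤ analyticOrderAt h 0 := by
  rw [natCast_le_analyticOrderAt_iff_iteratedDeriv_eq_zero hh, X_pow_dvd_iff]
  simp [coeff_taylor, Nat.factorial_ne_zero]

lemma order_taylor (hh : AnalyticAt ℂ h 0) : (taylor h).order = analyticOrderAt h 0 := by
  refine ENat.eq_of_forall_natCast_le_iff fun N => ?_
  rw [← X_pow_dvd_iff_le_order, X_pow_dvd_taylor_iff hh]

lemma taylor_congr (hhg : h =ᶠ[𝓝 0] g) : taylor h = taylor g := by
  ext k
  rw [coeff_taylor, coeff_taylor, (hhg.iteratedDeriv k).eq_of_nhds]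

lemma taylor_add (hh : AnalyticAt ℂ h 0) (hg : AnalyticAt ℂ g 0) :
    taylor (fun t => h t + g t) = taylor h + taylor g := by
  ext k
  rw [map_add, coeff_taylor, coeff_taylor, coeff_taylor,
    iteratedDeriv_fun_add hh.contDiffAt hg.contDiffAt, add_div]

lemma taylor_mul (hh : AnalyticAt ℂ h 0) (hg : AnalyticAt ℂ g 0) :
    taylor (fun t => h t * g t) = taylor h * taylor g := by
  ext k
  rw [coeff_taylor, show (fun t => h t * g t) = h * g from rfl,
    iteratedDeriv_mul hh.contDiffAt hg.contDiffAt, coeff_mul,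
    Finset.Nat.sum_antidiagonal_eq_sum_range_succ_mk, Finset.sum_div]
  refine Finset.sum_congr rfl fun i hi => ?_
  rw [Nat.cast_choose _ (by simpa [Nat.lt_succ_iff] using hi), coeff_taylor, coeff_taylor]
  field_simp [Nat.factorial_ne_zero]

lemma taylor_const (c : ℂ) : taylor (fun _ => c) = C c := by
  ext k
  rw [coeff_taylor, iteratedDeriv_const, coeff_C]
  split_ifs with hk <;> simp [hk]

lemma taylor_id : taylor (fun t => t) = X := by
  ext k
  rw [coeff_taylor, coeff_X]
  rcases k with _ | _ | k
  · simp
  · simp [iteratedDeriv_one]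
  · rw [iteratedDeriv_succ', iteratedDeriv_succ']
    simp

lemma taylor_pow (hh : AnalyticAt ℂ h 0) (n : ℕ) : taylor (fun t => h t ^ n) = taylor h ^ n := by
  induction n with
  | zero => simpa using taylor_const 1
  | succ n ih => simp_rw [pow_succ]; rw [taylor_mul (hh.fun_pow n) hh, ih]

lemma constantCoeff_taylor (h : ℂ → ℂ) : constantCoeff (taylor h) = h 0 := by
  rw [← coeff_zero_eq_constantCoeff_apply, coeff_taylor]
  simp

lemma eulerD_taylor (h : ℂ → ℂ) : eulerD (taylor h) = X * taylor (deriv h) := by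
  ext k
  rw [coeff_eulerD]
  cases k with
  | zero => simp
  | succ k =>
    rw [coeff_succ_X_mul, coeff_taylor, coeff_taylor, iteratedDeriv_succ', Nat.factorial_succ]
    push_cast
    field_simp [Nat.factorial_ne_zero]

end taylor

/-! ### Division of holomorphic germs by a coordinate -/

/-- The power series of the quotient `(q (x, z) - q (x, 0)) / z`: the `k`-th summand is one term of
the telescoping sum which replaces, one after another, the arguments `(x, z)` by `(x, 0)`. -/
noncomputable def divSeries (p : FormalMultilinearSeries ℂ (ℂ × ℂ) ℂ) :
    FormalMultilinearSeries ℂ (ℂ × ℂ) ℂ := fun n =>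
  ∑ k : Fin (n + 1), ((p (n + 1)).curryMid k (0, 1)).compContinuousLinearMap fun i : Fin n =>
    if (i : ℕ) < k then (ContinuousLinearMap.fst ℂ ℂ ℂ).prod 0 else .id ℂ (ℂ × ℂ)

lemma norm_divSeries_le (p : FormalMultilinearSeries ℂ (ℂ × ℂ) ℂ) (n : ℕ) :
    ‖divSeries p n‖ ≤ (n + 1) * ‖p (n + 1)‖ := by
  refine (norm_sum_le _ _).trans ?_
  have : ((n : ℝ) + 1) * ‖p (n + 1)‖ = ∑ k : Fin (n + 1), ‖p (n + 1)‖ := by simp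
  rw [this]
  refine Finset.sum_le_sum fun k _ => ?_
  refine (ContinuousMultilinearMap.norm_compContinuousLinearMap_le _ _).trans ?_
  have h1 : ‖(p (n + 1)).curryMid k (0, 1)‖ ≤ ‖p (n + 1)‖ := by
    refine (ContinuousLinearMap.le_opNorm _ _).trans ?_
    rw [ContinuousMultilinearMap.norm_curryMid]
    simp [Prod.norm_def]
  refine (mul_le_mul h1 (Finset.prod_le_one (fun _ _ => norm_nonneg _) fun i _ => ?_)
    (by positivity) (norm_nonneg _)).trans (mul_one _).le
  split_ifs
  · refine ContinuousLinearMap.opNorm_le_bound _ zero_le_one fun v => ?_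
    simp [Prod.norm_def]
  · exact ContinuousLinearMap.norm_id_le

lemma mul_divSeries_apply (p : FormalMultilinearSeries ℂ (ℂ × ℂ) ℂ) (n : ℕ) (v : ℂ × ℂ) :
    v.2 * divSeries p n (fun _ => v) = p (n + 1) (fun _ => v) - p (n + 1) (fun _ => (v.1, 0)) := by
  set u : ℕ → Fin (n + 1) → ℂ × ℂ := fun k i => if (i : ℕ) < k then (v.1, 0) else v with hu
  have htel := Finset.sum_range_sub' (fun k => p (n + 1) (u k)) (n + 1)
  have h0 : u 0 = fun _ => v := by ext i <;> simp [hu]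
  have hn : u (n + 1) = fun _ => (v.1, 0) := by
    funext i
    exact if_pos i.isLt
  rw [h0, hn] at htel
  rw [← htel, ← Fin.sum_univ_eq_sum_range
    (fun k => p (n + 1) (u k) - p (n + 1) (u (k + 1))), divSeries,
    sum_apply, Finset.mul_sum]
  refine Finset.sum_congr rfl fun k _ => ?_
  have hk : u k = Function.update (u k) k v := by
    rw [eq_comm, Function.update_eq_self_iff]
    simp [hu]
  have hk1 : u (k + 1) = Function.update (u k) k (v.1, 0) := by
    funext i
    rcases eq_or_ne i k with rfl | h
    · simp [hu]
    · have : (i : ℕ) ≠ k := fun h' => h (Fin.ext h')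
      simp only [hu, Function.update_of_ne h]
      congr 1
      simp only [eq_iff_iff]
      omega
  rw [hk1]
  nth_rewrite 1 [hk]
  rw [← ContinuousMultilinearMap.map_update_sub]
  have hv : v - (v.1, 0) = v.2 • ((0 : ℂ), (1 : ℂ)) := by ext <;> simp
  rw [hv, ContinuousMultilinearMap.map_update_smul, smul_eq_mul]
  congr 1
  rw [ContinuousMultilinearMap.compContinuousLinearMap_apply,
    ContinuousMultilinearMap.curryMid_apply]
  congr 1
  funext i
  refine Fin.succAboveCases k ?_ (fun j => ?_) i
  · simp
  · rw [Fin.insertNth_apply_succAbove, Function.update_of_ne (Fin.succAbove_ne k j)]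
    have : ((k.succAbove j : Fin (n + 1)) : ℕ) < k ↔ (j : ℕ) < k := by
      rcases lt_or_ge (j : ℕ) k with h | h
      · rw [Fin.succAbove_of_castSucc_lt _ _ (by simpa [Fin.lt_def] using h)]
        simp
      · rw [Fin.succAbove_of_le_castSucc _ _ (by simpa [Fin.le_def] using h)]
        simp
        omega
    simp only [hu, this]
    split_ifs <;> simp

/-- A germ `q (x, z)` is congruent to `q (x, 0)` modulo `z`. -/
lemma exists_eq_add_snd_mul {q : ℂ × ℂ → ℂ} (hq : AnalyticAt ℂ q 0) :
    ∃ K, AnalyticAt ℂ K 0 ∧ ∀ᶠ v in 𝓝 (0 : ℂ × ℂ), q v = q (v.1, 0) + v.2 * K v := by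
  obtain ⟨p, r, hp⟩ := hq
  obtain ⟨ρ, hρ0, hρr⟩ := ENNReal.lt_iff_exists_nnreal_btwn.1 hp.r_pos
  have hρ : 0 < (ρ : ℝ) := by exact_mod_cast hρ0
  obtain ⟨M, hM0, hM⟩ := p.norm_mul_pow_le_of_lt_radius (hρr.trans_le hp.r_le)
  have hrad : ((ρ / 2 : NNReal) : ENNReal) ≤ (divSeries p).radius := by
    refine (divSeries p).le_radius_of_bound (M / ρ) fun n => ?_
    have h2 : ((n : ℝ) + 1) / 2 ^ n ≤ 1 := by
      rw [div_le_one (by positivity)]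
      exact_mod_cast Nat.lt_two_pow_self (n := n)
    calc ‖divSeries p n‖ * ((ρ / 2 : NNReal) : ℝ) ^ n
        ≤ (n + 1) * ‖p (n + 1)‖ * ((ρ / 2 : NNReal) : ℝ) ^ n := by
          gcongr
          exact norm_divSeries_le p n
      _ = ‖p (n + 1)‖ * ρ ^ (n + 1) / ρ * ((n + 1) / 2 ^ n) := by
          push_cast
          rw [div_pow, pow_succ]
          field_simp
      _ ≤ M / ρ * 1 := by
          gcongr
          exact hM (n + 1)
      _ = M / ρ := mul_one _
  have hpos : 0 < (divSeries p).radius :=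
    lt_of_lt_of_le (by exact_mod_cast half_pos (show 0 < ρ from hρ)) hrad
  have hK := (divSeries p).hasFPowerSeriesOnBall hpos
  refine ⟨(divSeries p).sum, hK.analyticAt, ?_⟩
  filter_upwards [Metric.eball_mem_nhds (0 : ℂ × ℂ) hpos,
    Metric.eball_mem_nhds (0 : ℂ × ℂ) hp.r_pos] with v hv1 hv2
  have hP : (v.1, (0 : ℂ)) ∈ Metric.eball (0 : ℂ × ℂ) r := by
    rw [Metric.mem_eball] at hv2 ⊢
    refine lt_of_le_of_lt ?_ hv2
    rw [Prod.edist_eq, Prod.edist_eq]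
    exact max_le (le_max_left _ _) (by simp)
  have s1 := hp.hasSum hv2
  have s2 := hp.hasSum hP
  have s3 := (hK.hasSum hv1).mul_left v.2
  simp only [zero_add] at s1 s2 s3
  have s4 := s1.sub s2
  rw [← hasSum_nat_add_iff' 1] at s4
  simp only [mul_divSeries_apply] at s3
  have h0 : p 0 (fun _ => v) - p 0 (fun _ => (v.1, (0 : ℂ))) = 0 := by
    rw [sub_eq_zero]
    congr 1
    funext i
    exact i.elim0
  rw [Finset.sum_range_one, h0, sub_zero] at s4
  rw [← s4.unique s3]
  ring

/-- Hadamard's lemma for germs at the origin of `ℂ²`. -/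
lemma exists_eq_add_fst_mul_add_snd_mul {q : ℂ × ℂ → ℂ} (hq : AnalyticAt ℂ q 0) :
    ∃ a b, AnalyticAt ℂ a 0 ∧ AnalyticAt ℂ b 0 ∧
      ∀ᶠ v in 𝓝 (0 : ℂ × ℂ), q v = q 0 + v.1 * a v + v.2 * b v := by
  obtain ⟨b, hb, hqb⟩ := exists_eq_add_snd_mul hq
  have hflip : AnalyticAt ℂ (fun v : ℂ × ℂ => q (v.2, 0)) 0 := by
    have hlin : AnalyticAt ℂ (fun v : ℂ × ℂ => (v.2, (0 : ℂ))) 0 :=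
      analyticAt_snd.prod analyticAt_const
    exact AnalyticAt.fun_comp (g := q) (x := (0 : ℂ × ℂ)) hq hlin
  obtain ⟨a, ha, hqa⟩ := exists_eq_add_snd_mul hflip
  have hswap : AnalyticAt ℂ (fun v : ℂ × ℂ => ((0 : ℂ), v.1)) 0 :=
    analyticAt_const.prod analyticAt_fst
  refine ⟨fun v => a (0, v.1), b, AnalyticAt.fun_comp (g := a) (x := (0 : ℂ × ℂ)) ha hswap, hb, ?_⟩
  have ht : Tendsto (fun v : ℂ × ℂ => ((0 : ℂ), v.1)) (𝓝 0) (𝓝 0) := by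
    exact hswap.continuousAt.tendsto
  filter_upwards [hqb, ht.eventually hqa] with v h1 h2
  rw [h1, h2]
  rfl

/-! ### Values of germs and of forms on a parametrized curve -/

section bridge

open PowerSeries

variable {φ : ℂ → ℂ × ℂ}

lemma analyticAt_fst_comp (hφ : AnalyticAt ℂ φ 0) : AnalyticAt ℂ (fun t => (φ t).1) 0 :=
  analyticAt_fst.comp hφ

lemma analyticAt_snd_comp (hφ : AnalyticAt ℂ φ 0) : AnalyticAt ℂ (fun t => (φ t).2) 0 :=
  analyticAt_snd.comp hφ

lemma analyticAt_comp_of_map_zero {q : ℂ × ℂ → ℂ} (hφ : AnalyticAt ℂ φ 0) (h0 : φ 0 = 0)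
    (hq : AnalyticAt ℂ q 0) : AnalyticAt ℂ (fun t => q (φ t)) 0 :=
  AnalyticAt.fun_comp (g := q) (by rwa [h0]) hφ

/-- The completed local ring of the curve parametrized by `φ`. -/
noncomputable abbrev paramRing (φ : ℂ → ℂ × ℂ) : Subalgebra ℂ (PowerSeries ℂ) :=
  curveRing (taylor fun t => (φ t).1) (taylor fun t => (φ t).2)

lemma taylor_comp_mem (hφ : AnalyticAt ℂ φ 0) (h0 : φ 0 = 0) {q : ℂ × ℂ → ℂ}
    (hq : AnalyticAt ℂ q 0) : taylor (fun t => q (φ t)) ∈ paramRing φ := by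
  intro N
  induction N generalizing q with
  | zero => exact ⟨0, zero_mem _, by simp⟩
  | succ N ih =>
    obtain ⟨a, b, ha, hb, hqab⟩ := exists_eq_add_fst_mul_add_snd_mul hq
    obtain ⟨α, hα, hdα⟩ := ih ha
    obtain ⟨β, hβ, hdβ⟩ := ih hb
    set x := taylor fun t => (φ t).1 with hx
    set y := taylor fun t => (φ t).2 with hy
    have hφ1 := analyticAt_fst_comp hφ
    have hφ2 := analyticAt_snd_comp hφ
    have haφ := analyticAt_comp_of_map_zero hφ h0 ha
    have hbφ := analyticAt_comp_of_map_zero hφ h0 hb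
    have ht : Tendsto φ (𝓝 0) (𝓝 0) := by simpa [h0] using hφ.continuousAt.tendsto
    have heq : taylor (fun t => q (φ t)) = C (q 0) + x * taylor (fun t => a (φ t)) +
        y * taylor (fun t => b (φ t)) := by
      rw [taylor_congr (ht.eventually hqab), taylor_add
        (analyticAt_const.fun_add (hφ1.fun_mul haφ)) (hφ2.fun_mul hbφ),
        taylor_add analyticAt_const (hφ1.fun_mul haφ), taylor_mul hφ1 haφ, taylor_mul hφ2 hbφ,
        taylor_const]
    have hXx : X ∣ x := by rw [X_dvd_iff, hx, constantCoeff_taylor, h0]; rfl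
    have hXy : X ∣ y := by rw [X_dvd_iff, hy, constantCoeff_taylor, h0]; rfl
    refine ⟨C (q 0) + x * α + y * β, add_mem (add_mem (C_mem _ _)
      (mul_mem (left_mem_adjoin x y) hα)) (mul_mem (right_mem_adjoin x y) hβ), ?_⟩
    rw [heq, pow_succ']
    convert dvd_add (mul_dvd_mul hXx hdα) (mul_dvd_mul hXy hdβ) using 1
    ring

lemma exists_taylor_comp_eq (hφ : AnalyticAt ℂ φ 0) (h0 : φ 0 = 0) {a : PowerSeries ℂ}
    (ha : a ∈ Algebra.adjoin ℂ {taylor fun t => (φ t).1, taylor fun t => (φ t).2}) :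
    ∃ q : ℂ × ℂ → ℂ, AnalyticAt ℂ q 0 ∧ taylor (fun t => q (φ t)) = a := by
  induction ha using Algebra.adjoin_induction with
  | mem z hz =>
    rcases hz with rfl | rfl
    exacts [⟨Prod.fst, analyticAt_fst, rfl⟩, ⟨Prod.snd, analyticAt_snd, rfl⟩]
  | algebraMap r => exact ⟨fun _ => r, analyticAt_const, taylor_const r⟩
  | add u v _ _ hu hv =>
    obtain ⟨p, hp, rfl⟩ := hu
    obtain ⟨q, hq, rfl⟩ := hv
    exact ⟨fun v => p v + q v, hp.fun_add hq, taylor_add (analyticAt_comp_of_map_zero hφ h0 hp)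
      (analyticAt_comp_of_map_zero hφ h0 hq)⟩
  | mul u v _ _ hu hv =>
    obtain ⟨p, hp, rfl⟩ := hu
    obtain ⟨q, hq, rfl⟩ := hv
    exact ⟨fun v => p v * q v, hp.fun_mul hq, taylor_mul (analyticAt_comp_of_map_zero hφ h0 hp)
      (analyticAt_comp_of_map_zero hφ h0 hq)⟩

lemma valueSemigroup_eq (hφ : AnalyticAt ℂ φ 0) (h0 : φ 0 = 0) :
    valueSemigroup φ = orders (paramRing φ) := by
  ext k
  constructor
  · rintro ⟨q, hq, hk⟩
    exact ⟨_, taylor_comp_mem hφ h0 hq,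
      by rw [order_taylor (analyticAt_comp_of_map_zero hφ h0 hq), hk]⟩
  · rintro ⟨h, hh, hk⟩
    obtain ⟨a, ha, hd⟩ := hh (k + 1)
    obtain ⟨q, hq, rfl⟩ := exists_taylor_comp_eq hφ h0 ha
    refine ⟨q, hq, ?_⟩
    rw [← order_taylor (analyticAt_comp_of_map_zero hφ h0 hq)]
    exact order_eq_of_X_pow_dvd_sub hk (Nat.lt_succ_self k) hd

lemma analyticAt_pullbackForm (hφ : AnalyticAt ℂ φ 0) (h0 : φ 0 = 0) {A B : ℂ × ℂ → ℂ}
    (hA : AnalyticAt ℂ A 0) (hB : AnalyticAt ℂ B 0) : AnalyticAt ℂ (pullbackForm φ A B) 0 :=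
  ((analyticAt_comp_of_map_zero hφ h0 hA).fun_mul (analyticAt_fst_comp hφ).deriv).fun_add
    ((analyticAt_comp_of_map_zero hφ h0 hB).fun_mul (analyticAt_snd_comp hφ).deriv)

lemma X_mul_taylor_pullbackForm (hφ : AnalyticAt ℂ φ 0) (h0 : φ 0 = 0) {A B : ℂ × ℂ → ℂ}
    (hA : AnalyticAt ℂ A 0) (hB : AnalyticAt ℂ B 0) :
    X * taylor (pullbackForm φ A B) =
      taylor (fun t => A (φ t)) * eulerD (taylor fun t => (φ t).1) +
        taylor (fun t => B (φ t)) * eulerD (taylor fun t => (φ t).2) := by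
  have hAφ := analyticAt_comp_of_map_zero hφ h0 hA
  have hBφ := analyticAt_comp_of_map_zero hφ h0 hB
  have h1 := (analyticAt_fst_comp hφ).deriv
  have h2 := (analyticAt_snd_comp hφ).deriv
  rw [eulerD_taylor, eulerD_taylor, show pullbackForm φ A B = fun t =>
    A (φ t) * deriv (fun u => (φ u).1) t + B (φ t) * deriv (fun u => (φ u).2) t from rfl,
    taylor_add (hAφ.fun_mul h1) (hBφ.fun_mul h2), taylor_mul hAφ h1, taylor_mul hBφ h2]
  ring

lemma order_X_mul_taylor_pullbackForm (hφ : AnalyticAt ℂ φ 0) (h0 : φ 0 = 0)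
    {A B : ℂ × ℂ → ℂ} (hA : AnalyticAt ℂ A 0) (hB : AnalyticAt ℂ B 0) :
    (X * taylor (pullbackForm φ A B)).order = analyticOrderAt (pullbackForm φ A B) 0 + 1 := by
  rw [order_mul, order_X, order_taylor (analyticAt_pullbackForm hφ h0 hA hB), add_comm]

lemma valueSetForms_eq (hφ : AnalyticAt ℂ φ 0) (h0 : φ 0 = 0) :
    valueSetForms φ = formOrders (paramRing φ) := by
  ext k
  constructor
  · rintro ⟨A, B, hA, hB, hk⟩
    rw [← order_X_mul_taylor_pullbackForm hφ h0 hA hB, X_mul_taylor_pullbackForm hφ h0 hA hB]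
      at hk
    exact ⟨_, add_mem
      (mul_mem_forms (taylor_comp_mem hφ h0 hA) (eulerD_mem_forms (left_mem_curveRing _ _)))
      (mul_mem_forms (taylor_comp_mem hφ h0 hB) (eulerD_mem_forms (right_mem_curveRing _ _))), hk⟩
  · rintro ⟨w, hw, hk⟩
    obtain ⟨a, ha, b, hb, hd⟩ := exists_adjoin_of_mem_forms hw (k + 1)
    obtain ⟨A, hA, rfl⟩ := exists_taylor_comp_eq hφ h0 ha
    obtain ⟨B, hB, rfl⟩ := exists_taylor_comp_eq hφ h0 hb
    refine ⟨A, B, hA, hB, ?_⟩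
    rw [← order_X_mul_taylor_pullbackForm hφ h0 hA hB, X_mul_taylor_pullbackForm hφ h0 hA hB]
    exact order_eq_of_X_pow_dvd_sub hk (Nat.lt_succ_self k) hd

end bridge

/-! ### The multiplicity of the parametrization -/

/-- A local inverse at the origin of a germ of order one. -/
lemma exists_local_inverse {h : ℂ → ℂ} (hh : AnalyticAt ℂ h 0) (h0 : h 0 = 0)
    (hd : deriv h 0 ≠ 0) : ∃ τ : ℂ → ℂ, AnalyticAt ℂ τ 0 ∧ τ 0 = 0 ∧
      (∀ᶠ z in 𝓝 0, h (τ z) = z) ∧ ∀ᶠ t in 𝓝 0, τ (h t) = t := by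
  refine ⟨hh.hasStrictDerivAt.localInverse _ _ _ hd, ?_, ?_, ?_, ?_⟩
  · simpa [h0] using hh.analyticAt_localInverse hd
  · have := (hh.hasStrictDerivAt.eventually_left_inverse hd).self_of_nhds
    rwa [h0] at this
  · simpa [h0] using hh.hasStrictDerivAt.eventually_right_inverse hd
  · exact hh.hasStrictDerivAt.eventually_left_inverse hd

/-- A germ vanishing along a smooth curve, transversal to `x = 0`, is divisible by the equation of
this curve. -/
lemma exists_factor_of_deriv_fst_ne_zero {f : ℂ × ℂ → ℂ} {φ : ℂ → ℂ × ℂ} (hf : AnalyticAt ℂ f 0)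
    (hφ : AnalyticAt ℂ φ 0) (h0 : φ 0 = 0) (hfφ : ∀ᶠ t in 𝓝 (0 : ℂ), f (φ t) = 0)
    (hd : deriv (fun t => (φ t).1) 0 ≠ 0) :
    ∃ g k : ℂ × ℂ → ℂ, AnalyticAt ℂ g 0 ∧ AnalyticAt ℂ k 0 ∧ g 0 = 0 ∧
      (∃ G : ℂ × ℂ →L[ℂ] ℂ, HasFDerivAt g G 0 ∧ G ≠ 0) ∧ ∀ᶠ v in 𝓝 0, f v = g v * k v := by
  obtain ⟨τ, hτ, hτ0, hr, -⟩ := exists_local_inverse (analyticAt_fst_comp hφ) (by simp [h0]) hd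
  set s : ℂ → ℂ := fun x => (φ (τ x)).2 with hs
  have hs0 : s 0 = 0 := by simp [hs, hτ0, h0]
  have hsa : AnalyticAt ℂ s 0 :=
    AnalyticAt.fun_comp (g := fun t => (φ t).2) (by rw [hτ0]; exact analyticAt_snd_comp hφ) hτ
  have hs1 : AnalyticAt ℂ (fun v : ℂ × ℂ => s v.1) 0 :=
    AnalyticAt.fun_comp (g := s) (x := (0 : ℂ × ℂ)) hsa analyticAt_fst
  have hF : AnalyticAt ℂ (fun v : ℂ × ℂ => f (v.1, s v.1 + v.2)) 0 := by
    have he : ((0 : ℂ × ℂ).1, s (0 : ℂ × ℂ).1 + (0 : ℂ × ℂ).2) = 0 := by simp [hs0]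
    exact AnalyticAt.fun_comp (g := f) (x := (0 : ℂ × ℂ)) (by rwa [he])
      (analyticAt_fst.prod (hs1.fun_add analyticAt_snd))
  obtain ⟨K, hK, hFK⟩ := exists_eq_add_snd_mul hF
  have hsh : AnalyticAt ℂ (fun v : ℂ × ℂ => (v.1, v.2 - s v.1)) 0 :=
    analyticAt_fst.prod (analyticAt_snd.fun_sub hs1)
  have hsh0 : ((0 : ℂ × ℂ).1, (0 : ℂ × ℂ).2 - s (0 : ℂ × ℂ).1) = 0 := by simp [hs0]
  have htend : Tendsto (fun v : ℂ × ℂ => (v.1, v.2 - s v.1)) (𝓝 0) (𝓝 0) := by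
    have := hsh.continuousAt.tendsto
    rwa [hsh0] at this
  refine ⟨fun v => v.2 - s v.1, fun v => K (v.1, v.2 - s v.1), analyticAt_snd.fun_sub hs1,
    AnalyticAt.fun_comp (g := K) (by rwa [hsh0]) hsh, by simp [hs0],
    ⟨_, (hasFDerivAt_snd (p := (0 : ℂ × ℂ))).fun_sub
      (HasFDerivAt.comp (g := s) (0 : ℂ × ℂ) hsa.differentiableAt.hasFDerivAt hasFDerivAt_fst),
      fun h => ?_⟩, ?_⟩
  · have := DFunLike.congr_fun h ((0 : ℂ), (1 : ℂ))
    simp at this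
  · have hfst : Tendsto (fun v : ℂ × ℂ => v.1) (𝓝 0) (𝓝 0) :=
      (continuous_fst (X := ℂ) (Y := ℂ)).tendsto 0
    have hτt : Tendsto τ (𝓝 0) (𝓝 0) := by simpa [hτ0] using hτ.continuousAt.tendsto
    filter_upwards [htend.eventually hFK, hfst.eventually hr,
      hfst.eventually (hτt.eventually hfφ)] with v h1 h2 h3
    simp only [add_sub_cancel, add_zero] at h1
    have h4 : (v.1, s v.1) = φ (τ v.1) := Prod.ext h2.symm rfl
    rw [h4, h3, zero_add] at h1
    exact h1

lemma HolGerm.ne_zero_of_isUnit {g : ℂ × ℂ → ℂ} (hg : AnalyticAt ℂ g 0)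
    (hu : IsUnit (HolGerm.of g hg)) : g 0 ≠ 0 := by
  obtain ⟨⟨_, U, hU, rfl⟩, h⟩ := hu.exists_right_inv
  have h1 : ((g * U : ℂ × ℂ → ℂ) : Germ (𝓝 (0 : ℂ × ℂ)) ℂ) = ((1 : ℂ × ℂ → ℂ) : Germ _ _) :=
    congrArg Subtype.val h
  have h2 : g 0 * U 0 = 1 := (Germ.coe_eq.1 h1).self_of_nhds
  exact left_ne_zero_of_mul (h2 ▸ one_ne_zero)

lemma not_smooth_factor {f g k : ℂ × ℂ → ℂ} (hf : IsPlaneBranch f) (hg : AnalyticAt ℂ g 0)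
    (hk : AnalyticAt ℂ k 0) (hg0 : g 0 = 0) {G : ℂ × ℂ →L[ℂ] ℂ} (hG : HasFDerivAt g G 0)
    (hG0 : G ≠ 0) (hfgk : ∀ᶠ v in 𝓝 0, f v = g v * k v) : False := by
  have hmul : HolGerm.of f hf.analyticAt = HolGerm.of g hg * HolGerm.of k hk :=
    Subtype.ext (Germ.coe_eq.2 hfgk)
  have hk0 : k 0 ≠ 0 := by
    rcases hf.irreducible.isUnit_or_isUnit hmul with h | h
    · exact absurd hg0 (HolGerm.ne_zero_of_isUnit hg h)
    · exact HolGerm.ne_zero_of_isUnit hk h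
  have h1 := (hG.mul hk.differentiableAt.hasFDerivAt).congr_of_eventuallyEq hfgk
  have h2 := h1.fderiv
  refine hG0 (ContinuousLinearMap.ext fun v => ?_)
  have h3 : fderiv ℂ f 0 v = g 0 * fderiv ℂ k 0 v + k 0 * G v := DFunLike.congr_fun h2 v
  rw [hf.fderiv_zero, hg0, zero_mul, zero_add] at h3
  exact (mul_eq_zero.1 h3.symm).resolve_left hk0

/-- A parametrization of a singular branch is singular. -/
lemma deriv_eq_zero_of_isPlaneBranch {f : ℂ × ℂ → ℂ} {φ : ℂ → ℂ × ℂ} (hf : IsPlaneBranch f)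
    (hφ : AnalyticAt ℂ φ 0) (h0 : φ 0 = 0) (hfφ : ∀ᶠ t in 𝓝 (0 : ℂ), f (φ t) = 0) :
    deriv (fun t => (φ t).1) 0 = 0 ∧ deriv (fun t => (φ t).2) 0 = 0 := by
  constructor
  · by_contra hd
    obtain ⟨g, k, hg, hk, hg0, ⟨G, hG, hG0⟩, hfgk⟩ :=
      exists_factor_of_deriv_fst_ne_zero hf.analyticAt hφ h0 hfφ hd
    exact not_smooth_factor hf hg hk hg0 hG hG0 hfgk
  · by_contra hd
    have hsw : AnalyticAt ℂ (Prod.swap : ℂ × ℂ → ℂ × ℂ) 0 := analyticAt_snd.prod analyticAt_fst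
    have hfs : AnalyticAt ℂ (fun v : ℂ × ℂ => f v.swap) 0 :=
      AnalyticAt.fun_comp (g := f) (x := (0 : ℂ × ℂ)) hf.analyticAt hsw
    have hφs : AnalyticAt ℂ (fun t => (φ t).swap) 0 :=
      (analyticAt_snd_comp hφ).prod (analyticAt_fst_comp hφ)
    obtain ⟨g, k, hg, hk, hg0, ⟨G, hG, hG0⟩, hfgk⟩ :=
      exists_factor_of_deriv_fst_ne_zero hfs hφs (by rw [h0]; rfl) (by simpa using hfφ) hd
    have hswt : Tendsto (Prod.swap : ℂ × ℂ → ℂ × ℂ) (𝓝 0) (𝓝 0) := hsw.continuousAt.tendsto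
    refine not_smooth_factor hf (g := fun v => g v.swap) (k := fun v => k v.swap)
      (G := G.comp ((ContinuousLinearMap.snd ℂ ℂ ℂ).prod (ContinuousLinearMap.fst ℂ ℂ ℂ)))
      (AnalyticAt.fun_comp (g := g) (x := (0 : ℂ × ℂ)) hg hsw)
      (AnalyticAt.fun_comp (g := k) (x := (0 : ℂ × ℂ)) hk hsw) hg0 ?_ ?_ ?_
    · exact HasFDerivAt.comp (g := g) (f := Prod.swap) (0 : ℂ × ℂ) hG
        (hasFDerivAt_snd.prodMk hasFDerivAt_fst)
    · intro h
      refine hG0 (ContinuousLinearMap.ext fun v => ?_)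
      simpa using DFunLike.congr_fun h v.swap
    · filter_upwards [hswt.eventually hfgk] with v hv
      simpa using hv

/-! ### The conductor of a primitive parametrization -/

section conductor

open PowerSeries

lemma mem_curveRing_of_rescale_eq {n : ℕ} {ζ : ℂ} (hζ : IsPrimitiveRoot ζ n)
    {c : PowerSeries ℂ} (hc : rescale ζ c = c) (y : PowerSeries ℂ) :
    c ∈ curveRing (X ^ n) y := by
  have hzero : ∀ k, ¬ n ∣ k → coeff k c = 0 := by
    intro k hk
    have h1 := congrArg (coeff k) hc
    rw [coeff_rescale] at h1
    have h2 : (ζ ^ k - 1) * coeff k c = 0 := by rw [sub_mul, h1]; ring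
    refine (mul_eq_zero.1 h2).resolve_left fun h => hk ?_
    exact (hζ.pow_eq_one_iff_dvd k).1 (sub_eq_zero.1 h)
  intro N
  refine ⟨∑ k ∈ Finset.range N with n ∣ k, C (coeff k c) * X ^ k, sum_mem fun k hk => ?_, ?_⟩
  · obtain ⟨i, rfl⟩ := (Finset.mem_filter.1 hk).2
    rw [pow_mul]
    exact mul_mem (C_mem _ _) (pow_mem (left_mem_adjoin _ _) _)
  · rw [X_pow_dvd_iff]
    intro k hk
    simp only [map_sub, map_sum, coeff_C_mul, coeff_X_pow, mul_ite, mul_one, mul_zero]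
    rw [Finset.sum_ite_eq, sub_eq_zero]
    split_ifs with h
    · rfl
    · refine hzero k fun hd => h ?_
      simp [hk, hd]

/-- The polynomial `∑_z (z X) ^ r ∏_{w ≠ z} (Y - y (w X))` over the `n`-th roots of unity `z`. -/
noncomputable def conjSum (n r : ℕ) (y : PowerSeries ℂ) : Polynomial (PowerSeries ℂ) :=
  ∑ z ∈ Polynomial.nthRootsFinset n (1 : ℂ), Polynomial.C (rescale z (X ^ r)) *
    ∏ w ∈ (Polynomial.nthRootsFinset n (1 : ℂ)).erase z,
      (Polynomial.X - Polynomial.C (rescale w y))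

lemma map_conjSum {n : ℕ} (hn : 0 < n) (r : ℕ) (y : PowerSeries ℂ) {ζ : ℂ} (hζ : ζ ^ n = 1) :
    (conjSum n r y).map (rescale ζ) = conjSum n r y := by
  have hζ0 : ζ ≠ 0 := by
    rintro rfl
    simp [hn.ne'] at hζ
  have hmem : ∀ z : ℂ, z ∈ Polynomial.nthRootsFinset n (1 : ℂ) ↔
      Equiv.mulRight₀ ζ hζ0 z ∈ Polynomial.nthRootsFinset n (1 : ℂ) := by
    intro z
    simp [Polynomial.mem_nthRootsFinset hn, mul_pow, hζ]
  have hresc : ∀ (z : ℂ) (u : PowerSeries ℂ),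
      rescale ζ (rescale z u) = rescale (Equiv.mulRight₀ ζ hζ0 z) u := by
    intro z u
    rw [rescale_rescale]
    rfl
  rw [conjSum, Polynomial.map_sum]
  refine Finset.sum_equiv (Equiv.mulRight₀ ζ hζ0) hmem fun z _ => ?_
  rw [Polynomial.map_mul, Polynomial.map_C, hresc, Polynomial.map_prod]
  congr 1
  refine Finset.prod_equiv (Equiv.mulRight₀ ζ hζ0) (fun w => ?_) fun w _ => ?_
  · rw [Finset.mem_erase, Finset.mem_erase, hmem w, (Equiv.mulRight₀ ζ hζ0).injective.ne_iff]
  · rw [Polynomial.map_sub, Polynomial.map_X, Polynomial.map_C, hresc]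

/-- If the conjugates of `y` over `ℂ⟦X ^ n⟧` are distinct, then the ring of the curve `(X ^ n, y)`
contains all multiples of `∏ (y - y (z X))`, so that it has two consecutive values. -/
lemma exists_consecutive_orders {n : ℕ} (hn : 0 < n) {y : PowerSeries ℂ}
    (hy : ∀ z : ℂ, z ^ n = 1 → rescale z y = y → z = 1) :
    ∃ v, v ∈ orders (curveRing (X ^ n) y) ∧ v + 1 ∈ orders (curveRing (X ^ n) y) := by
  set S := Polynomial.nthRootsFinset n (1 : ℂ) with hS
  have h1S : (1 : ℂ) ∈ S := by simp [hS, Polynomial.mem_nthRootsFinset hn]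
  set δ : PowerSeries ℂ := ∏ w ∈ S.erase 1, (y - rescale w y) with hδ
  have hδ0 : δ ≠ 0 := by
    rw [hδ, Finset.prod_ne_zero_iff]
    intro w hw h
    obtain ⟨hw1, hwS⟩ := Finset.mem_erase.1 hw
    exact hw1 (hy w ((Polynomial.mem_nthRootsFinset hn (1 : ℂ)).1 hwS) (sub_eq_zero.1 h).symm)
  have heval : ∀ r, (conjSum n r y).eval y = X ^ r * δ := by
    intro r
    rw [conjSum, Polynomial.eval_finsetSum, Finset.sum_eq_single_of_mem 1 h1S]
    · simp [Polynomial.eval_prod, hδ, hS]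
    · intro z _ hz
      rw [Polynomial.eval_mul, Polynomial.eval_prod,
        Finset.prod_eq_zero (Finset.mem_erase.2 ⟨hz.symm, h1S⟩) (by simp), mul_zero]
  have hζ := Complex.isPrimitiveRoot_exp n hn.ne'
  have hmem : ∀ r, X ^ r * δ ∈ curveRing (X ^ n) y := by
    intro r
    rw [← heval, Polynomial.eval_eq_sum_range]
    refine sum_mem fun j _ => mul_mem ?_ (pow_mem (right_mem_curveRing _ _) _)
    refine mem_curveRing_of_rescale_eq hζ ?_ y
    rw [← Polynomial.coeff_map, map_conjSum hn r y hζ.pow_eq_one]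
  obtain ⟨v, hv⟩ := ENat.ne_top_iff_exists.1 (order_finite_iff_ne_zero.2 hδ0).ne
  refine ⟨v, ⟨_, hmem 0, ?_⟩, ⟨_, hmem 1, ?_⟩⟩
  · simp [← hv]
  · rw [order_mul, order_X_pow, ← hv]
    push_cast
    ring

end conductor

/-- A germ whose Taylor series is a series in `s ^ d` is a holomorphic function of `s ^ d`. -/
lemma exists_eq_comp_pow {y : ℂ → ℂ} (hy : AnalyticAt ℂ y 0) {d : ℕ} (hd : 0 < d)
    (hdvd : ∀ k, ¬ d ∣ k → PowerSeries.coeff k (taylor y) = 0) :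
    ∃ ψ, AnalyticAt ℂ ψ 0 ∧ ∀ᶠ s in 𝓝 (0 : ℂ), y s = ψ (s ^ d) := by
  have hp := hy.hasFPowerSeriesAt
  simp_rw [← coeff_taylor] at hp
  set a : ℕ → ℂ := fun k => PowerSeries.coeff k (taylor y) with ha
  obtain ⟨r, hr⟩ := hp
  obtain ⟨ρ, hρ0, hρr⟩ := ENNReal.lt_iff_exists_nnreal_btwn.1 hr.r_pos
  have hρ : 0 < ρ := by exact_mod_cast hρ0
  obtain ⟨M, hM0, hM⟩ := FormalMultilinearSeries.norm_mul_pow_le_of_lt_radius _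
    (hρr.trans_le hr.r_le)
  set b := FormalMultilinearSeries.ofScalars ℂ fun k => a (d * k) with hb
  have hrad : ((ρ ^ d : NNReal) : ENNReal) ≤ b.radius := by
    refine b.le_radius_of_bound M fun k => ?_
    have := hM (d * k)
    rw [FormalMultilinearSeries.ofScalars_norm] at this ⊢
    rwa [NNReal.coe_pow, ← pow_mul]
  have hpos : 0 < b.radius := lt_of_lt_of_le (by exact_mod_cast pow_pos hρ d) hrad
  have hψ := b.hasFPowerSeriesOnBall hpos
  refine ⟨b.sum, hψ.analyticAt, ?_⟩
  have ht : Tendsto (fun s : ℂ => s ^ d) (𝓝 0) (𝓝 0) := by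
    have := (continuous_pow (M := ℂ) d).tendsto 0
    rwa [zero_pow hd.ne'] at this
  filter_upwards [Metric.eball_mem_nhds (0 : ℂ) hr.r_pos,
    ht.eventually (Metric.eball_mem_nhds (0 : ℂ) hpos)] with s hs1 hs2
  have s1 := hr.hasSum hs1
  have s2 := hψ.hasSum hs2
  simp only [zero_add, hb, FormalMultilinearSeries.ofScalars_apply_eq, smul_eq_mul] at s1 s2
  have hinj : Function.Injective fun k : ℕ => d * k :=
    fun i j h => Nat.eq_of_mul_eq_mul_left hd h
  rw [← hinj.hasSum_iff] at s1
  · refine s1.unique ?_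
    convert s2 using 2 with k
    simp [pow_mul]
  · intro k hk
    have : ¬ d ∣ k := by
      rintro ⟨i, rfl⟩
      exact hk ⟨i, rfl⟩
    rw [show a k = 0 from hdvd k this, zero_mul]

/-- A germ of order `n` is the `n`-th power of a coordinate. -/
lemma exists_eq_pow {h : ℂ → ℂ} (hh : AnalyticAt ℂ h 0) {n : ℕ} (hn : n ≠ 0)
    (ho : analyticOrderAt h 0 = n) : ∃ τ : ℂ → ℂ, AnalyticAt ℂ τ 0 ∧ τ 0 = 0 ∧ deriv τ 0 ≠ 0 ∧
      ∀ᶠ t in 𝓝 (0 : ℂ), h t = τ t ^ n := by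
  obtain ⟨g, hg, hg0, hgh⟩ := hh.analyticOrderAt_eq_natCast.1 ho
  obtain ⟨c, hc⟩ := IsAlgClosed.exists_pow_nat_eq (g 0) (Nat.pos_of_ne_zero hn)
  have hc0 : c ≠ 0 := by
    rintro rfl
    rw [zero_pow hn] at hc
    exact hg0 hc.symm
  set u : ℂ → ℂ := fun t => c * Complex.exp (Complex.log (g t / g 0) / n) with hu
  have hua : AnalyticAt ℂ u 0 := by
    refine analyticAt_const.fun_mul (AnalyticAt.cexp ?_)
    refine AnalyticAt.fun_div ?_ analyticAt_const (by exact_mod_cast hn)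
    refine (hg.fun_div analyticAt_const hg0).clog ?_
    rw [div_self hg0]
    exact Complex.one_mem_slitPlane
  have hu0 : u 0 ≠ 0 := mul_ne_zero hc0 (Complex.exp_ne_zero _)
  refine ⟨fun t => t * u t, analyticAt_id.fun_mul hua, by simp, ?_, ?_⟩
  · have := (hasDerivAt_id (0 : ℂ)).fun_mul hua.differentiableAt.hasDerivAt
    rw [show deriv (fun t => t * u t) 0 = _ from this.deriv]
    simpa using hu0
  · have hne : ∀ᶠ t in 𝓝 (0 : ℂ), g t ≠ 0 := hg.continuousAt.eventually_ne hg0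
    filter_upwards [hgh, hne] with t ht hgt
    rw [ht, sub_zero, smul_eq_mul, mul_pow, hu]
    simp only
    rw [mul_pow, hc, ← Complex.exp_nat_mul, mul_div_cancel₀ _ (by exact_mod_cast hn),
      Complex.exp_log (div_ne_zero hgt hg0), mul_div_cancel₀ _ hg0]

/-- The values of functions do not depend on the parameter. -/
lemma valueSemigroup_comp {φ : ℂ → ℂ × ℂ} {θ : ℂ → ℂ} (hθ : AnalyticAt ℂ θ 0) (h0 : θ 0 = 0)
    (hd : deriv θ 0 ≠ 0) : valueSemigroup (fun s => φ (θ s)) = valueSemigroup φ := by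
  have : ∀ q : ℂ × ℂ → ℂ, analyticOrderAt (fun s => q (φ (θ s))) 0 =
      analyticOrderAt (fun t => q (φ t)) 0 := by
    intro q
    have := analyticOrderAt_comp_of_deriv_ne_zero (f := fun t => q (φ t)) hθ hd
    rwa [h0] at this
  simp only [valueSemigroup, this]

lemma exists_consecutive_of_fst_ne_zero {φ : ℂ → ℂ × ℂ} (hφ : AnalyticAt ℂ φ 0) (h0 : φ 0 = 0)
    (hprim : ∀ (ψ : ℂ → ℂ × ℂ) (σ : ℂ → ℂ), AnalyticAt ℂ ψ 0 → AnalyticAt ℂ σ 0 → σ 0 = 0 →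
      (∀ᶠ t in 𝓝 (0 : ℂ), φ t = ψ (σ t)) → analyticOrderAt σ 0 = 1)
    (hne : analyticOrderAt (fun t => (φ t).1) 0 ≠ ⊤) :
    ∃ v, v ∈ valueSemigroup φ ∧ v + 1 ∈ valueSemigroup φ := by
  obtain ⟨n, hn⟩ := ENat.ne_top_iff_exists.1 hne
  have hφ1 := analyticAt_fst_comp hφ
  have hn0 : n ≠ 0 := by
    have : analyticOrderAt (fun t => (φ t).1) 0 ≠ 0 :=
      hφ1.analyticOrderAt_ne_zero.2 (by simp [h0])
    rw [← hn] at this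
    exact_mod_cast this
  obtain ⟨τ, hτ, hτ0, hτd, hτn⟩ := exists_eq_pow hφ1 hn0 hn.symm
  obtain ⟨θ, hθ, hθ0, hr, hl⟩ := exists_local_inverse hτ hτ0 hτd
  have hθd : deriv θ 0 ≠ 0 := by
    intro h
    have h1 := HasDerivAt.comp (h₂ := τ) (0 : ℂ)
      (by rw [hθ0]; exact hτ.differentiableAt.hasDerivAt) hθ.differentiableAt.hasDerivAt
    have h2 := (h1.congr_of_eventuallyEq (hr.mono fun z hz => hz.symm)).unique (hasDerivAt_id 0)
    rw [h, mul_zero] at h2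
    exact zero_ne_one h2
  have hτt : Tendsto τ (𝓝 0) (𝓝 0) := by simpa [hτ0] using hτ.continuousAt.tendsto
  have hθt : Tendsto θ (𝓝 0) (𝓝 0) := by simpa [hθ0] using hθ.continuousAt.tendsto
  have hφθ : AnalyticAt ℂ (fun s => φ (θ s)) 0 :=
    AnalyticAt.fun_comp (g := φ) (by rwa [hθ0]) hθ
  have hφθ0 : φ (θ 0) = 0 := by rw [hθ0, h0]
  rw [← valueSemigroup_comp hθ hθ0 hθd, valueSemigroup_eq hφθ hφθ0, paramRing]
  have hx : taylor (fun s => (φ (θ s)).1) = PowerSeries.X ^ n := by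
    rw [← taylor_id, ← taylor_pow (h := fun t => t) analyticAt_id]
    refine taylor_congr ?_
    filter_upwards [hθt.eventually hτn, hr] with s h1 h2
    rw [h1, h2]
  rw [hx]
  refine exists_consecutive_orders (Nat.pos_of_ne_zero hn0) fun z hz hzy => ?_
  -- If a conjugate of `y` equals `y`, then `φ` is a function of `τ ^ d`, with `d` the order of `z`.
  have hdn : orderOf z ∣ n := orderOf_dvd_of_pow_eq_one hz
  set d := orderOf z with hd
  have hd0 : 0 < d := Nat.pos_of_dvd_of_pos hdn (Nat.pos_of_ne_zero hn0)
  obtain ⟨ψ, hψ, hψy⟩ := exists_eq_comp_pow (analyticAt_snd_comp hφθ) hd0 fun k hk => by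
    have h1 := congrArg (PowerSeries.coeff k) hzy
    rw [PowerSeries.coeff_rescale] at h1
    have h2 : (z ^ k - 1) * PowerSeries.coeff k (taylor fun s => (φ (θ s)).2) = 0 := by
      rw [sub_mul, h1]; ring
    exact (mul_eq_zero.1 h2).resolve_left fun h =>
      hk (orderOf_dvd_of_pow_eq_one (sub_eq_zero.1 h))
  obtain ⟨e, he⟩ := hdn
  have h1 := hprim (fun u => (u ^ e, ψ u)) (fun t => τ t ^ d)
    ((analyticAt_id.fun_pow e).prod hψ) (hτ.fun_pow d) (by simp [hτ0, hd0.ne']) (by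
      filter_upwards [hτn, hτt.eventually hψy, hl] with t h1 h2 h3
      rw [h3] at h2
      refine Prod.ext ?_ h2
      rw [h1, ← pow_mul, ← he])
  rw [show (fun t => τ t ^ d) = τ ^ d from rfl, analyticOrderAt_pow hτ,
    hτ.analyticOrderAt_eq_one_of_zero_deriv_ne_zero hτ0 hτd] at h1
  have h2 : d = 1 := by simpa using h1
  exact orderOf_eq_one_iff.1 h2

/-- The semigroup of a primitive parametrization contains two consecutive integers. -/
lemma exists_consecutive_of_isPrimitiveParametrization {f : ℂ × ℂ → ℂ} {φ : ℂ → ℂ × ℂ}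
    (hφ : IsPrimitiveParametrization f φ) :
    ∃ v, v ∈ valueSemigroup φ ∧ v + 1 ∈ valueSemigroup φ := by
  by_cases h1 : analyticOrderAt (fun t => (φ t).1) 0 = ⊤
  swap
  · exact exists_consecutive_of_fst_ne_zero hφ.analyticAt hφ.map_zero hφ.primitive h1
  by_cases h2 : analyticOrderAt (fun t => (φ t).2) 0 = ⊤
  · -- A constant parametrization is not primitive: it factors through `t ^ 2`.
    exfalso
    have h3 := hφ.primitive (fun _ => 0) (fun t => t ^ 2) analyticAt_const
      (analyticAt_id.fun_pow 2) (by simp) (by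
        filter_upwards [analyticOrderAt_eq_top.1 h1, analyticOrderAt_eq_top.1 h2] with t h3 h4
        exact Prod.ext h3 h4)
    rw [show (fun t : ℂ => t ^ 2) = id ^ 2 from rfl, analyticOrderAt_pow analyticAt_id,
      analyticOrderAt_id] at h3
    norm_num at h3
  · have hφs : AnalyticAt ℂ (fun t => (φ t).swap) 0 :=
      (analyticAt_snd_comp hφ.analyticAt).prod (analyticAt_fst_comp hφ.analyticAt)
    have hφs0 : (φ 0).swap = 0 := by rw [hφ.map_zero]; rfl
    have h3 := exists_consecutive_of_fst_ne_zero hφs hφs0 (fun ψ σ hψ hσ hσ0 h =>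
      hφ.primitive (fun u => (ψ u).swap) σ
        ((analyticAt_snd_comp hψ).prod (analyticAt_fst_comp hψ)) hσ hσ0
        (h.mono fun t ht => by rw [← ht, Prod.swap_swap])) h2
    rw [valueSemigroup_eq hφs hφs0, paramRing, curveRing_comm] at h3
    rwa [valueSemigroup_eq hφ.analyticAt hφ.map_zero]

end PlaneCurve

theorem proposition4p3 (f : ℂ × ℂ → ℂ) (φ : ℂ → ℂ × ℂ) (hf : IsPlaneBranch f)
    (hφ : IsPrimitiveParametrization f φ) :
    gapSet φ = ∅ ↔
      (∃ v₀ v₁ : ℕ, v₀ < v₁ ∧ IsMinimalGeneratingSet (valueSemigroup φ) {v₀, v₁} ∧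
        lambdaOne φ = ⊤) ∨
      (∃ v₀ v₁ : ℕ, v₀ < v₁ ∧ IsMinimalGeneratingSet (valueSemigroup φ) {v₀, v₁} ∧
        ∃ s l : ℕ, 1 ≤ s ∧ s ≤ v₁ / v₀ + 1 ∧ lambdaOne φ = (l : ℕ∞) ∧
          (l : ℤ) = ((v₀ : ℤ) - 1) * v₁ - s * v₀) ∨
      (∃ v₂ : ℕ, 6 < v₂ ∧ IsMinimalGeneratingSet (valueSemigroup φ) {4, 6, v₂}) := by
  have ha := hφ.analyticAt
  have h0 := hφ.map_zero
  have hΓ := PlaneCurve.valueSemigroup_eq ha h0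
  have hΛ := PlaneCurve.valueSetForms_eq ha h0
  have hord : ∀ h : ℂ → ℂ, AnalyticAt ℂ h 0 → h 0 = 0 → deriv h 0 = 0 →
      (2 : ℕ∞) ≤ (PlaneCurve.taylor h).order := by
    intro h hh hh0 hd
    rw [PlaneCurve.order_taylor hh, show (2 : ℕ∞) = ((2 : ℕ) : ℕ∞) from rfl,
      natCast_le_analyticOrderAt_iff_iteratedDeriv_eq_zero hh]
    intro i hi
    interval_cases i
    · simpa using hh0
    · simpa [iteratedDeriv_one] using hd
  obtain ⟨hd1, hd2⟩ := PlaneCurve.deriv_eq_zero_of_isPlaneBranch hf ha h0 hφ.comp_eq_zero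
  obtain ⟨n, m, H⟩ := PlaneCurve.exists_branchValues
    (hord _ (PlaneCurve.analyticAt_fst_comp ha) (by simp [h0]) hd1)
    (hord _ (PlaneCurve.analyticAt_snd_comp ha) (by simp [h0]) hd2) fun d hd => by
      obtain ⟨v, hv, hv1⟩ := PlaneCurve.exists_consecutive_of_isPrimitiveParametrization hφ
      rw [hΓ] at hv hv1
      by_cases hdv : d ∣ v
      · refine ⟨v + 1, hv1, fun h => ?_⟩
        have := Nat.le_of_dvd one_pos ((Nat.dvd_add_right hdv).1 h)
        omega
      · exact ⟨v, hv, hdv⟩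
  rw [← PlaneCurve.paramRing, ← hΓ, ← hΛ] at H
  exact H.gaps_eq_empty_iff rfl
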